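/- Let $k\ge 2$, let $\mathscr M\subset\mathbb R^k$ be open, and let $(X_t)_{t\ge 0}$ be a (time-homogeneous, conservative) strong Markov process with càdlàg sample paths in $\mathscr M$: on one probability space with probability $\mathbb P$, $X_t(z)$ denotes its position at time $t$ when it starts at $z\in\mathscr M$, and $\mathbb P_z$, $\mathbb E_z$ refer to the law of $(X_t(z))_{t\ge0}$. Let $V:\mathscr M\to\mathbb R$ be continuous and bounded from below, and assume that for all $z\in\mathscr M$ and $t\ge0$ the integral $\int_0^t V(X_s(z))\,ds$ is almost surely finite. For a Borel set $A$, let $b\mathcal B(A)$ be the set of bounded Borel functions $A\to\mathbb R$. Assume that: - $[\mathrm{SF}_0]$ for every $t>0$ and $f\in b\mathcal B(\mathscr M)$, the map $z\in\mathscr M\mapsto \mathbb E_z[f(X_t)]$ is continuous; - $[\mathrm P_{t=s}]$ for every $t\ge 0$, the map $z\in\mathscr M\mapsto X_t(z)$ is continuous in $\mathbb P$-probability; - $[\mathrm D_e]$ for every $t>0$ and $z\in\mathscr M$, the law of $X_t(z)$ has a density with respect to the Lebesgue measure; - $[IV]$ for every $t\ge 0$ and all $z_n\to z$ in $\mathscr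 M$, $\int_0^t V(X_s(z_n))\,ds\to\int_0^t V(X_s(z))\,ds$ in $\mathbb P$-probability. Then the non-killed Feynman–Kac semigroup is strongly Feller: for every $t>0$ and $f\in b\mathcal B(\mathscr M)$, the map $$z\in\mathscr M\mapsto \mathbb E_z\Big[f(X_t)\,e^{-\int_0^tV(X_s)ds}\Big]$$ is continuous. Let moreover $\mathscr V\subset\mathscr M$ be a subdomain (a nonempty, connected, open subset), let $\sigma_{\mathscr V}=\inf\{t\ge0: X_t\notin\mathscr V\}$, and assume in addition that - $[\mathrm B]$ for every compact subset $K$ of $\mathscr V$, $\lim_{s\to0^+}\sup_{z\in K}\mathbb P_z[\sigma_{\mathscr V}\le s]=0$. Then the killed Feynman–Kac semigroup is strongly Feller: for every $t>0$ and $f\in b\mathcal B(\mathscr V)$, the map $$z\in\mathscr V\mapsto \mathbb E_z\Big[f(X_t)\,e^{-\int_0^tV(X_s)ds}\,\mathbf 1_{t<\sigma_{\mathscr V}}\Big]$$ is continuous. -/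

import Mathlib

open MeasureTheory ProbabilityTheory Filter Topology Set
open scoped NNReal ENNReal

namespace FeynmanKac

/-- Bounded Borel functions on a space. -/
def IsBoundedMeasurable {S : Type*} [MeasurableSpace S] (f : S → ℝ) : Prop :=
  Measurable f ∧ ∃ C : ℝ, ∀ x, |f x| ≤ C

/-- Càdlàg paths: right-continuous at every time, with a left limit in `S` at every time
(the condition on the left limit is void at time `0`). -/
def IsCadlag {S : Type*} [TopologicalSpace S] (x : ℝ≥0 → S) : Prop :=
  ∀ t : ℝ≥0, ContinuousWithinAt x (Ici t) t ∧ ∃ l : S, Tendsto x (𝓝[<] t) (𝓝 l)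

/-- The law of the whole path of `X`, as a measure on the path space `S ^ [0, ∞)` with the
product `σ`-algebra. -/
noncomputable def pathLaw {Ω S : Type*} [MeasurableSpace Ω] [MeasurableSpace S]
    (P : Measure Ω) (X : ℝ≥0 → Ω → S) : Measure (ℝ≥0 → S) :=
  P.map (fun ω t => X t ω)

/-- `X z t` is the position at time `t` of the process started at `z`; all these processes live on
one probability space, and `𝓕 z` is a filtration for the process started at `z`. They form
a (time-homogeneous, conservative) strong Markov process with càdlàg paths in `S`; the law
`ℙ_z` of the process started at `z` is `pathLaw P (X z)`. -/
structure IsCadlagStrongMarkov {Ω S : Type*} [mΩ : MeasurableSpace Ω] [MeasurableSpace S]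
    [TopologicalSpace S] (P : Measure Ω) (𝓕 : S → Filtration ℝ≥0 mΩ)
    (X : S → ℝ≥0 → Ω → S) : Prop where
  adapted : ∀ z t, Measurable[𝓕 z t] (X z t)
  start : ∀ z, ∀ᵐ ω ∂P, X z 0 ω = z
  cadlag : ∀ z, ∀ᵐ ω ∂P, IsCadlag (fun t => X z t ω)
  measurable_law : Measurable (fun z => pathLaw P (X z))
  /-- For every start point `z`, every stopping time `τ`, every event `G` of the past of `τ` and
  every event `A` of the path space,
  `P (G, τ < ∞, X_{τ + ·}(z) ∈ A) = E [1_{G, τ < ∞} ℙ_{X_τ(z)} (A)]`. -/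
  strong_markov : ∀ (z : S) (τ : Ω → WithTop ℝ≥0) (hτ : IsStoppingTime (𝓕 z) τ)
    (G : Set Ω), MeasurableSet[hτ.measurableSpace] G →
    ∀ A : Set (ℝ≥0 → S), MeasurableSet A →
      P {ω | ω ∈ G ∧ τ ω ≠ ⊤ ∧ (fun u : ℝ≥0 => X z ((τ ω).untopD 0 + u) ω) ∈ A}
        = ∫⁻ ω in {ω | ω ∈ G ∧ τ ω ≠ ⊤}, pathLaw P (X (X z ((τ ω).untopD 0) ω)) A ∂P

/-- The integral of the potential along the path started at `z`, `∫₀ᵗ V (X_s(z)) ds`. -/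
noncomputable def potentialIntegral {Ω S : Type*} (X : S → ℝ≥0 → Ω → S) (V : S → ℝ)
    (z : S) (t : ℝ≥0) (ω : Ω) : ℝ :=
  ∫ s in (0 : ℝ)..t, V (X z s.toNNReal ω)

/-- The first exit time `inf {t ≥ 0 : X_t(z) ∉ D}`, equal to `⊤` if there is no such `t`. -/
noncomputable def exitTime {Ω S : Type*} (X : S → ℝ≥0 → Ω → S) (D : Set S) (z : S) :
    Ω → WithTop ℝ≥0 :=
  hittingAfter (X z) Dᶜ 0

/-- The transition semigroup `U_t f (z) = E_z [f (X_t)]`. -/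
noncomputable def transition {Ω S : Type*} [MeasurableSpace Ω] (P : Measure Ω)
    (X : S → ℝ≥0 → Ω → S) (t : ℝ≥0) (f : S → ℝ) (z : S) : ℝ :=
  ∫ ω, f (X z t ω) ∂P

/-- The non-killed Feynman–Kac semigroup `T_t f (z) = E_z [f (X_t) exp (-∫₀ᵗ V (X_s) ds)]`. -/
noncomputable def feynmanKac {Ω S : Type*} [MeasurableSpace Ω] (P : Measure Ω)
    (X : S → ℝ≥0 → Ω → S) (V : S → ℝ) (t : ℝ≥0) (f : S → ℝ) (z : S) : ℝ :=
  ∫ ω, f (X z t ω) * Real.exp (-potentialIntegral X V z t ω) ∂P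

/-- The killed Feynman–Kac semigroup
`Q_t f (z) = E_z [f (X_t) exp (-∫₀ᵗ V (X_s) ds) 1_{t < σ_D}]` for `f` and `z` living on `D`.
The function `f` is extended by `0` outside `D`, which is immaterial since `X_t ∈ D` if
`t < σ_D`. -/
noncomputable def killedFeynmanKac {Ω S : Type*} [MeasurableSpace Ω] (P : Measure Ω)
    (X : S → ℝ≥0 → Ω → S) (V : S → ℝ) (D : Set S) (t : ℝ≥0) (f : D → ℝ) (z : D) : ℝ :=
  ∫ ω, Function.extend Subtype.val f 0 (X z t ω)
    * Real.exp (-potentialIntegral X V z t ω)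
    * Set.indicator {ω' | (t : WithTop ℝ≥0) < exitTime X D z ω'} (fun _ => (1 : ℝ)) ω ∂P

end FeynmanKac

/-!
Write `T` for the non-killed and `Q` for the killed semigroup.

If `z_n → z`, then along a subsequence `X_t(z_n) → X_t(z)` almost surely, and so do the integrals of
the potential. By `[SF₀]` the laws of `X_t(z_n)` moreover converge setwise, so `f(X_t(z_n))`
converges in `L¹` even for discontinuous `f`: replace `f` by a continuous function close to it in
`L¹` of the limit law. Since `V` is bounded from below, the exponential weights are bounded, and
`T_t f` is continuous.

For the killed semigroup, the Markov property at time `s` gives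
`|Q_t f(z) - T_s Q_{t-s} f(z)| ≤ C exp(c t) ℙ_z[σ ≤ s]`, so by `[B]` the functions `T_s Q_{t-s} f`,
continuous by the first part, converge to `Q_t f` uniformly on compact subsets of the domain as
`s → 0`.

The Markov property needs `Q_{t-s} f` to be an integral over the path space `S ^ [0, ∞)`, on whose
product `σ`-algebra neither the integral of the potential nor the event `t < σ` is measurable. They
are replaced by functionals of countably many coordinates. For the exit time this means that the
path stays at a positive distance from the complement of the domain at a countable dense set of
times; that a path coming arbitrarily close to the complement does hit it is the
quasi-left-continuity of the process.
-/

namespace FeynmanKac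

section Grid

/-- The smallest multiple of `1 / (n + 1)` strictly above `s`. Being strictly above makes a
discretised time `gridAbove n τ` a stopping time as soon as the events `{τ < c}` are adapted. -/
noncomputable def gridAbove (n : ℕ) (s : ℝ≥0) : ℝ≥0 := (⌊s * (n + 1)⌋₊ + 1) / (n + 1)

lemma le_gridAbove (n : ℕ) (s : ℝ≥0) : s ≤ gridAbove n s := by
  rw [gridAbove, le_div_iff₀ (by positivity)]
  exact (Nat.lt_floor_add_one _).le

lemma gridAbove_le_add (n : ℕ) (s : ℝ≥0) : gridAbove n s ≤ s + 1 / (n + 1) := by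
  rw [gridAbove, add_div]
  gcongr
  rw [div_le_iff₀ (by positivity)]
  exact Nat.floor_le zero_le

lemma tendsto_gridAbove (s : ℝ≥0) : Tendsto (fun n => gridAbove n s) atTop (𝓝 s) := by
  refine tendsto_of_tendsto_of_tendsto_of_le_of_le tendsto_const_nhds ?_
    (fun n => le_gridAbove n s) (fun n => gridAbove_le_add n s)
  simpa using (tendsto_const_nhds (x := s)).add
    (tendsto_one_div_add_atTop_nhds_zero_nat (𝕜 := ℝ≥0))

lemma gridAbove_le_iff (n : ℕ) (s c : ℝ≥0) :
    gridAbove n s ≤ c ↔ s < ⌊c * (n + 1)⌋₊ / (n + 1) := by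
  have hn : (0 : ℝ≥0) < n + 1 := by positivity
  rw [gridAbove, div_le_iff₀ hn, lt_div_iff₀ hn, ← Nat.cast_add_one, ← Nat.le_floor_iff zero_le,
    Nat.add_one_le_iff, Nat.floor_lt zero_le]

lemma measurable_comp_gridAbove {Ω S : Type*} {m : MeasurableSpace Ω} [MeasurableSpace S]
    {Y : ℝ≥0 → Ω → S} (hY : ∀ u, Measurable (Y u)) {τ : Ω → ℝ≥0} (hτ : Measurable τ) (n : ℕ) :
    Measurable fun ω => Y (gridAbove n (τ ω)) ω := by
  have hcell : Measurable fun p : Ω × ℕ => Y ((p.2 + 1) / (n + 1)) p.1 :=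
    measurable_from_prod_countable_left fun j => hY ((j + 1) / (n + 1))
  have hfloor : Measurable fun ω => (ω, ⌊τ ω * (n + 1)⌋₊) :=
    measurable_id.prodMk (Nat.measurable_floor.comp (hτ.mul_const _))
  simpa only [gridAbove, Function.comp_def] using hcell.comp hfloor

end Grid

namespace IsCadlag

variable {S : Type*} [TopologicalSpace S] {x : ℝ≥0 → S}

lemma comp {E : Type*} [TopologicalSpace E] {g : S → E} (hx : IsCadlag x) (hg : Continuous g) :
    IsCadlag fun t => g (x t) := fun t =>
  let ⟨l, hl⟩ := (hx t).2
  ⟨hg.continuousAt.comp_continuousWithinAt (hx t).1, g l, (hg.tendsto l).comp hl⟩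

lemma shift (hx : IsCadlag x) (s : ℝ≥0) : IsCadlag fun u => x (s + u) := by
  intro t
  have hadd : Tendsto (s + ·) (𝓝 t) (𝓝 (s + t)) := (continuous_const_add s).tendsto t
  obtain ⟨hright, l, hl⟩ := hx (s + t)
  refine ⟨hright.tendsto.comp (tendsto_nhdsWithin_iff.2 ⟨hadd.mono_left nhdsWithin_le_nhds, ?_⟩),
    l, hl.comp (tendsto_nhdsWithin_iff.2 ⟨hadd.mono_left nhdsWithin_le_nhds, ?_⟩)⟩
  · filter_upwards [self_mem_nhdsWithin] with u hu using add_le_add_right (mem_Ici.1 hu) s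
  · filter_upwards [self_mem_nhdsWithin] with u hu using add_lt_add_right (mem_Iio.1 hu) s

lemma tendsto_of_ge (hx : IsCadlag x) {ι : Type*} {l : Filter ι} {T : ι → ℝ≥0} {L : ℝ≥0}
    (hle : ∀ i, L ≤ T i) (hL : Tendsto T l (𝓝 L)) : Tendsto (fun i => x (T i)) l (𝓝 (x L)) :=
  (hx L).1.tendsto.comp (tendsto_nhdsWithin_iff.2 ⟨hL, Eventually.of_forall hle⟩)

lemma tendsto_gridAbove (hx : IsCadlag x) (s : ℝ≥0) :
    Tendsto (fun n => x (gridAbove n s)) atTop (𝓝 (x s)) :=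
  hx.tendsto_of_ge (fun n => le_gridAbove n s) (FeynmanKac.tendsto_gridAbove s)

lemma exists_tendsto_of_monotone (hx : IsCadlag x) {T : ℕ → ℝ≥0} (hT : Monotone T) {L : ℝ≥0}
    (hL : Tendsto T atTop (𝓝 L)) : ∃ l, Tendsto (fun n => x (T n)) atTop (𝓝 l) := by
  by_cases h : ∃ N, T N = L
  · obtain ⟨N, rfl⟩ := h
    refine ⟨x (T N), tendsto_const_nhds.congr' ?_⟩
    filter_upwards [eventually_ge_atTop N] with n hn
    rw [(hT hn).antisymm (hT.ge_of_tendsto hL n)]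
  · obtain ⟨l, hl⟩ := (hx L).2
    exact ⟨l, hl.comp (tendsto_nhdsWithin_iff.2 ⟨hL, Eventually.of_forall fun n =>
      (hT.ge_of_tendsto hL n).lt_of_ne fun hn => h ⟨n, hn⟩⟩)⟩

lemma measurable {E : Type*} [TopologicalSpace E] [TopologicalSpace.PseudoMetrizableSpace E]
    [MeasurableSpace E] [BorelSpace E] {y : ℝ≥0 → E} (hy : IsCadlag y) : Measurable y :=
  measurable_of_tendsto_metrizable
    (fun n => measurable_comp_gridAbove (fun u => measurable_const (a := y u)) measurable_id n)
    (tendsto_pi_nhds.2 hy.tendsto_gridAbove)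

lemma isBounded_image_Iic {E : Type*} [PseudoMetricSpace E] {y : ℝ≥0 → E} (hy : IsCadlag y)
    (t : ℝ≥0) : Bornology.IsBounded (y '' Iic t) := by
  rw [← Icc_bot]
  refine isCompact_Icc.induction_on (p := fun A => Bornology.IsBounded (y '' A)) (by simp)
    (fun A B hAB hB => hB.subset (image_mono hAB)) (fun A B hA hB => ?_) fun s _ => ?_
  · rw [image_union]
    exact hA.union hB
  · obtain ⟨hright, l, hl⟩ := hy s
    obtain ⟨A, hA, hAb⟩ := Metric.exists_isBounded_image_of_tendsto hright.tendsto
    obtain ⟨B, hB, hBb⟩ := Metric.exists_isBounded_image_of_tendsto hl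
    refine ⟨B ∪ A, mem_nhdsWithin_of_mem_nhds ?_, image_union y B A ▸ hBb.union hAb⟩
    rw [← nhdsLT_sup_nhdsGE s]
    exact union_mem_sup hB hA

lemma exists_abs_le {y : ℝ≥0 → ℝ} (hy : IsCadlag y) (t : ℝ≥0) : ∃ C, ∀ s ≤ t, |y s| ≤ C := by
  obtain ⟨C, hC⟩ := (hy.isBounded_image_Iic t).exists_norm_le
  exact ⟨C, fun s hs => hC _ (mem_image_of_mem y hs)⟩

lemma intervalIntegrable {y : ℝ≥0 → ℝ} (hy : IsCadlag y) (s t : ℝ≥0) :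
    IntervalIntegrable (fun r : ℝ => y r.toNNReal) volume s t := by
  obtain ⟨C, hC⟩ := hy.exists_abs_le (max s t)
  refine (intervalIntegrable_const (c := C)).mono_fun
    (hy.measurable.comp measurable_real_toNNReal).aestronglyMeasurable ?_
  filter_upwards [ae_restrict_mem measurableSet_uIoc] with r hr
  refine (hC _ (Real.toNNReal_le_iff_le_coe.2 ?_)).trans (le_abs_self C)
  simpa using hr.2

end IsCadlag

section Weight

/-- The integral of `y` over `[0, t]` with the time rounded up to the grid `ℕ / (n + 1)`, and
capped at `t` so that it depends on `y` up to time `t` only. -/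
noncomputable def gridIntegral (n : ℕ) (t : ℝ≥0) (y : ℝ≥0 → ℝ) : ℝ :=
  ∫ s in (0 : ℝ)..t, y (min (gridAbove n s.toNNReal) t)

/-- The Feynman–Kac weight `exp (-∫₀ᵗ y)` of the path `y` of the potential. Unlike the integral,
the limit of its discretisations is measurable on the whole product space of paths; it is clipped
at the a priori bound for paths `y ≥ -c`. -/
noncomputable def weight (c : ℝ) (t : ℝ≥0) (y : ℝ≥0 → ℝ) : ℝ :=
  min (Real.exp (-limsup (fun n => gridIntegral n t y) atTop)) (Real.exp (c * t))

lemma weight_nonneg (c : ℝ) (t : ℝ≥0) (y : ℝ≥0 → ℝ) : 0 ≤ weight c t y :=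
  le_min (Real.exp_pos _).le (Real.exp_pos _).le

lemma abs_weight_le (c : ℝ) (t : ℝ≥0) (y : ℝ≥0 → ℝ) : |weight c t y| ≤ Real.exp (c * t) :=
  (abs_of_nonneg (weight_nonneg c t y)).trans_le (min_le_right _ _)

lemma measurable_gridIntegral {Ω : Type*} {m : MeasurableSpace Ω} {t : ℝ≥0} {Y : ℝ≥0 → Ω → ℝ}
    (hY : ∀ u ≤ t, Measurable (Y u)) (n : ℕ) :
    Measurable fun ω => gridIntegral n t fun u => Y u ω := by
  have hjoint : Measurable fun p : Ω × ℝ => Y (min (gridAbove n p.2.toNNReal) t) p.1 :=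
    measurable_comp_gridAbove (fun u => (hY _ (min_le_right u t)).comp measurable_fst)
      (measurable_real_toNNReal.comp measurable_snd) n
  simpa only [gridIntegral, intervalIntegral.integral_of_le t.coe_nonneg] using
    (hjoint.stronglyMeasurable.integral_prod_right'
      (ν := volume.restrict (Ioc (0 : ℝ) t))).measurable

lemma measurable_weight {Ω : Type*} {_ : MeasurableSpace Ω} {t : ℝ≥0} {Y : ℝ≥0 → Ω → ℝ}
    (hY : ∀ u ≤ t, Measurable (Y u)) (c : ℝ) : Measurable fun ω => weight c t fun u => Y u ω :=
  (Real.measurable_exp.comp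
    (Measurable.limsup fun n => measurable_gridIntegral hY n).neg).min measurable_const

namespace IsCadlag

variable {y : ℝ≥0 → ℝ}

lemma tendsto_gridIntegral (hy : IsCadlag y) (t : ℝ≥0) :
    Tendsto (fun n => gridIntegral n t y) atTop (𝓝 (∫ s in (0 : ℝ)..t, y s.toNNReal)) := by
  obtain ⟨C, hC⟩ := hy.exists_abs_le t
  refine intervalIntegral.tendsto_integral_filter_of_dominated_convergence (fun _ => C)
    (Eventually.of_forall fun n => ?_)
    (Eventually.of_forall fun n => ae_of_all _ fun s _ => hC _ (min_le_right _ _))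
    intervalIntegrable_const (ae_of_all _ fun s hs => ?_)
  · exact (measurable_comp_gridAbove (fun u => measurable_const (a := y (min u t)))
      measurable_real_toNNReal n).aestronglyMeasurable
  · rw [uIoc_of_le t.coe_nonneg] at hs
    have hst : s.toNNReal ≤ t := Real.toNNReal_le_iff_le_coe.2 hs.2
    refine hy.tendsto_of_ge (fun n => le_min (le_gridAbove n _) hst) ?_
    simpa only [min_eq_left hst] using (FeynmanKac.tendsto_gridAbove s.toNNReal).min
      (tendsto_const_nhds (x := t))

lemma weight_eq (hy : IsCadlag y) {c : ℝ} (hc : ∀ s, -c ≤ y s) (t : ℝ≥0) :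
    weight c t y = Real.exp (-∫ s in (0 : ℝ)..t, y s.toNNReal) := by
  have hint : ∫ _ in (0 : ℝ)..t, -c ≤ ∫ s in (0 : ℝ)..t, y s.toNNReal :=
    intervalIntegral.integral_mono_on t.coe_nonneg intervalIntegrable_const
      (by simpa using hy.intervalIntegrable 0 t) fun s _ => hc s.toNNReal
  rw [intervalIntegral.integral_const, sub_zero, smul_eq_mul] at hint
  rw [weight, (hy.tendsto_gridIntegral t).limsup_eq]
  exact min_eq_left (Real.exp_le_exp.2 (by linarith))

lemma weight_add (hy : IsCadlag y) {c : ℝ} (hc : ∀ s, -c ≤ y s) (s u : ℝ≥0) :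
    weight c (s + u) y = weight c s y * weight c u fun r => y (s + r) := by
  have hshift : ∫ r in (0 : ℝ)..u, y (s + r.toNNReal)
      = ∫ r in (s : ℝ)..(s + u : ℝ≥0), y r.toNNReal := by
    have hcongr : ∫ r in (0 : ℝ)..u, y (s + r.toNNReal) = ∫ r in (0 : ℝ)..u, y (s + r).toNNReal :=
      intervalIntegral.integral_congr fun r hr => by
        rw [uIcc_of_le u.coe_nonneg] at hr
        simp only [Real.toNNReal_add s.coe_nonneg hr.1, Real.toNNReal_coe]
    rw [hcongr, intervalIntegral.integral_comp_add_left fun r => y r.toNNReal, add_zero,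
      NNReal.coe_add]
  rw [hy.weight_eq hc, hy.weight_eq hc, (hy.shift s).weight_eq fun r => hc (s + r), hshift,
    ← Real.exp_add, ← neg_add, intervalIntegral.integral_add_adjacent_intervals
      (by simpa using hy.intervalIntegrable 0 s) (hy.intervalIntegrable s (s + u))]

end IsCadlag

end Weight

section Survival

/-- A countable set of times up to `t`, containing `t`, that is dense enough to detect the passage
of a right-continuous path through an open set up to time `t`. -/
def timeNet (t : ℝ≥0) : Set ℝ≥0 := insert t (range (TopologicalSpace.denseSeq ℝ≥0) ∩ Iio t)

lemma countable_timeNet (t : ℝ≥0) : (timeNet t).Countable :=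
  ((countable_range _).mono inter_subset_left).insert t

lemma le_of_mem_timeNet {s t : ℝ≥0} (hs : s ∈ timeNet t) : s ≤ t :=
  hs.elim le_of_eq fun h => le_of_lt h.2

lemma self_mem_timeNet (t : ℝ≥0) : t ∈ timeNet t := mem_insert t _

/-- The paths that are bounded away from `0` from below up to time `t`, as tested on a countable
set of times; see `IsCadlag.mem_survival_iff`. -/
def survival (t : ℝ≥0) : Set (ℝ≥0 → ℝ) := {y | ∃ n : ℕ, ∀ s ∈ timeNet t, 1 / ((n : ℝ) + 1) ≤ y s}

/-- The entrance time of a path into `(-∞, δ)`, as tested on a countable set of times and capped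
at `t`. -/
noncomputable def entry (δ : ℝ) (t : ℝ≥0) (y : ℝ≥0 → ℝ) : ℝ≥0 :=
  sInf {s | s ∈ timeNet t ∧ (s = t ∨ y s < δ)}

lemma nonempty_entry (δ : ℝ) (t : ℝ≥0) (y : ℝ≥0 → ℝ) :
    {s | s ∈ timeNet t ∧ (s = t ∨ y s < δ)}.Nonempty :=
  ⟨t, self_mem_timeNet t, Or.inl rfl⟩

lemma entry_le_of_mem {δ : ℝ} {s t : ℝ≥0} {y : ℝ≥0 → ℝ} (hs : s ∈ timeNet t) (h : y s < δ) :
    entry δ t y ≤ s :=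
  csInf_le' ⟨hs, Or.inr h⟩

lemma entry_le (δ : ℝ) (t : ℝ≥0) (y : ℝ≥0 → ℝ) : entry δ t y ≤ t :=
  csInf_le' ⟨self_mem_timeNet t, Or.inl rfl⟩

lemma entry_lt_iff {δ : ℝ} {t c : ℝ≥0} {y : ℝ≥0 → ℝ} :
    entry δ t y < c ↔ ∃ s ∈ timeNet t, s < c ∧ (s = t ∨ y s < δ) :=
  (csInf_lt_iff (OrderBot.bddBelow _) (nonempty_entry δ t y)).trans
    ⟨fun ⟨s, ⟨hs, h⟩, hc⟩ => ⟨s, hs, hc, h⟩, fun ⟨s, hs, hc, h⟩ => ⟨s, ⟨hs, h⟩, hc⟩⟩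

lemma antitone_entry (t : ℝ≥0) (y : ℝ≥0 → ℝ) : Antitone fun δ => entry δ t y := fun _ _ hδ =>
  csInf_le_csInf' (nonempty_entry _ t y)
    fun _ hs => ⟨hs.1, hs.2.imp_right fun h => h.trans_le hδ⟩

lemma monotone_entry (t : ℝ≥0) (y : ℝ≥0 → ℝ) :
    Monotone fun n : ℕ => entry (1 / ((n : ℝ) + 1)) t y := fun _ _ h =>
  antitone_entry t y (Nat.one_div_le_one_div h)

/-- The limit of the entrance times into `(-∞, 1 / (n + 1))`: the first time by which a path has
come arbitrarily close to `(-∞, 0]`, capped at `t`. -/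
noncomputable def approachTime (t : ℝ≥0) (y : ℝ≥0 → ℝ) : ℝ≥0 :=
  ⨆ n : ℕ, entry (1 / ((n : ℝ) + 1)) t y

lemma approachTime_le (t : ℝ≥0) (y : ℝ≥0 → ℝ) : approachTime t y ≤ t :=
  ciSup_le' fun _ => entry_le _ t y

lemma tendsto_entry (t : ℝ≥0) (y : ℝ≥0 → ℝ) :
    Tendsto (fun n : ℕ => entry (1 / ((n : ℝ) + 1)) t y) atTop (𝓝 (approachTime t y)) :=
  tendsto_atTop_ciSup (monotone_entry t y) ⟨t, forall_mem_range.2 fun _ => entry_le _ t y⟩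

lemma measurableSet_survival (t : ℝ≥0) : MeasurableSet (survival t) := by
  simp only [survival, ofPred_exists, ofPred_forall]
  exact .iUnion fun n => .biInter (countable_timeNet t) fun s _ =>
    measurableSet_le measurable_const (measurable_pi_apply s)

lemma measurableSet_entry_lt {Ω : Type*} {m : MeasurableSpace Ω} {c : ℝ≥0} {Y : ℝ≥0 → Ω → ℝ}
    (hY : ∀ u < c, Measurable (Y u)) (δ : ℝ) (t : ℝ≥0) :
    MeasurableSet {ω | entry δ t (fun u => Y u ω) < c} := by
  have hunion : {ω | entry δ t (fun u => Y u ω) < c}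
      = ⋃ s ∈ timeNet t ∩ Iio c, {ω | s = t ∨ Y s ω < δ} := by
    ext ω
    simp [entry_lt_iff, and_assoc]
  rw [hunion]
  exact .biUnion ((countable_timeNet t).mono inter_subset_left) fun s hs =>
    (MeasurableSet.const _).union (measurableSet_lt (hY s hs.2) measurable_const)

lemma eventually_entry_eq {t : ℝ≥0} {y : ℝ≥0 → ℝ} (hy : y ∈ survival t) :
    ∀ᶠ n : ℕ in atTop, entry (1 / ((n : ℝ) + 1)) t y = t := by
  obtain ⟨N, hN⟩ := hy
  filter_upwards [eventually_ge_atTop N] with n hn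
  refine (entry_le _ t y).antisymm (le_csInf (nonempty_entry _ t y) ?_)
  rintro s ⟨hs, rfl | h⟩
  · exact le_rfl
  · exact absurd (h.trans_le (one_div_le_one_div_of_le (by positivity) (by gcongr)))
      (hN s hs).not_gt

namespace IsCadlag

variable {y : ℝ≥0 → ℝ}

lemma exists_mem_timeNet_lt (hy : IsCadlag y) {s t : ℝ≥0} (hst : s ≤ t) {δ : ℝ} (h : y s < δ) :
    ∃ r ∈ timeNet t, y r < δ := by
  rcases hst.eq_or_lt with rfl | hst
  · exact ⟨s, self_mem_timeNet s, h⟩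
  · obtain ⟨b, hb, hsub⟩ :=
      (mem_nhdsGE_iff_exists_Ico_subset' hst).1 ((hy s).1.eventually (gt_mem_nhds h))
    obtain ⟨r, hr, hsr, hrlt⟩ := (TopologicalSpace.denseRange_denseSeq ℝ≥0).exists_between
      (lt_min hst hb : s < min t b)
    exact ⟨r, Or.inr ⟨hr, hrlt.trans_le (min_le_left _ _)⟩,
      hsub ⟨hsr.le, hrlt.trans_le (min_le_right _ _)⟩⟩

lemma mem_survival_iff (hy : IsCadlag y) (t : ℝ≥0) :
    y ∈ survival t ↔ ∃ δ > 0, ∀ s ≤ t, δ ≤ y s := by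
  constructor
  · rintro ⟨n, hn⟩
    refine ⟨1 / ((n : ℝ) + 1), by positivity, fun s hs => le_of_not_gt fun h => ?_⟩
    obtain ⟨r, hr, hlt⟩ := hy.exists_mem_timeNet_lt hs h
    exact (hn r hr).not_gt hlt
  · rintro ⟨δ, hδ, h⟩
    obtain ⟨n, hn⟩ := exists_nat_one_div_lt hδ
    exact ⟨n, fun s hs => hn.le.trans (h s (le_of_mem_timeNet hs))⟩

lemma mem_survival_add_iff (hy : IsCadlag y) (s u : ℝ≥0) :
    y ∈ survival (s + u) ↔ y ∈ survival s ∧ (fun r => y (s + r)) ∈ survival u := by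
  rw [hy.mem_survival_iff, hy.mem_survival_iff, (hy.shift s).mem_survival_iff]
  constructor
  · rintro ⟨δ, hδ, h⟩
    exact ⟨⟨δ, hδ, fun r hr => h r (hr.trans le_self_add)⟩,
      δ, hδ, fun r hr => h _ (add_le_add_right hr s)⟩
  · rintro ⟨⟨δ, hδ, h⟩, δ', hδ', h'⟩
    refine ⟨min δ δ', lt_min hδ hδ', fun r hr => ?_⟩
    rcases le_total r s with hrs | hsr
    · exact (min_le_left _ _).trans (h r hrs)
    · obtain ⟨v, rfl⟩ := exists_add_of_le hsr
      exact (min_le_right _ _).trans (h' v (le_of_add_le_add_left hr))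

lemma apply_entry_le (hy : IsCadlag y) {δ : ℝ} {s t : ℝ≥0} (hs : s ∈ timeNet t) (h : y s < δ) :
    y (entry δ t y) ≤ δ := by
  by_contra! hlt
  obtain ⟨b, hb, hsub⟩ := mem_nhdsGE_iff_exists_Ico_subset.1
    ((hy (entry δ t y)).1.eventually (lt_mem_nhds hlt))
  have habove : ∀ r ∈ timeNet t, r < b → ¬ y r < δ := fun r hr hrb hrδ =>
    lt_asymm hrδ (hsub ⟨entry_le_of_mem hr hrδ, hrb⟩)
  obtain ⟨r, hr, hrb, rfl | hrδ⟩ := entry_lt_iff.1 hb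
  · exact habove s hs ((le_of_mem_timeNet hs).trans_lt hrb) h
  · exact habove r hr hrb hrδ

lemma le_zero_of_tendsto_entry (hy : IsCadlag y) {t : ℝ≥0}
    (hyt : y ∉ survival t) {l : ℝ}
    (hl : Tendsto (fun n : ℕ => y (entry (1 / ((n : ℝ) + 1)) t y)) atTop (𝓝 l)) : l ≤ 0 := by
  refine le_of_tendsto_of_tendsto' hl tendsto_one_div_add_atTop_nhds_zero_nat fun n => ?_
  simp only [survival, mem_ofPred_eq, not_exists, not_forall, not_le] at hyt
  obtain ⟨s, hs, hlt⟩ := hyt n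
  exact hy.apply_entry_le hs hlt

lemma le_apply_approachTime (hy : IsCadlag y) (hy₀ : ∀ s, 0 ≤ y s) {t : ℝ≥0} {l : ℝ}
    (hl : Tendsto (fun n : ℕ => y (entry (1 / ((n : ℝ) + 1)) t y)) atTop (𝓝 l)) :
    l ≤ y (approachTime t y) := by
  by_cases hyt : y ∈ survival t
  · have hentry := eventually_entry_eq hyt
    have ht : approachTime t y = t := tendsto_nhds_unique (tendsto_entry t y)
      (tendsto_const_nhds.congr' (hentry.mono fun _ h => h.symm))
    rw [ht]
    exact le_of_tendsto hl (hentry.mono fun n h => (congrArg y h).le)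
  · exact (hy.le_zero_of_tendsto_entry hyt hl).trans (hy₀ _)

end IsCadlag

end Survival

namespace IsBoundedMeasurable

variable {α β : Type*} [MeasurableSpace α] [MeasurableSpace β] {f g : α → ℝ}

lemma comp (hf : IsBoundedMeasurable f) {W : β → α} (hW : Measurable W) :
    IsBoundedMeasurable fun b => f (W b) :=
  ⟨hf.1.comp hW, hf.2.imp fun _ hC b => hC (W b)⟩

lemma mul (hf : IsBoundedMeasurable f) (hg : IsBoundedMeasurable g) :
    IsBoundedMeasurable fun a => f a * g a := by
  obtain ⟨hfm, C, hC⟩ := hf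
  obtain ⟨hgm, C', hC'⟩ := hg
  refine ⟨hfm.mul hgm, C * C', fun a => ?_⟩
  rw [abs_mul]
  exact mul_le_mul (hC a) (hC' a) (abs_nonneg _) ((abs_nonneg _).trans (hC a))

lemma abs_sub (hf : IsBoundedMeasurable f) (hg : IsBoundedMeasurable g) :
    IsBoundedMeasurable fun a => |f a - g a| := by
  obtain ⟨hfm, C, hC⟩ := hf
  obtain ⟨hgm, C', hC'⟩ := hg
  refine ⟨(hfm.sub hgm).abs, C + C', fun a => ?_⟩
  rw [abs_abs]
  exact (_root_.abs_sub _ _).trans (add_le_add (hC a) (hC' a))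

lemma integrable (hf : IsBoundedMeasurable f) (μ : Measure α) [IsFiniteMeasure μ] :
    Integrable f μ :=
  let ⟨C, hC⟩ := hf.2
  .of_bound hf.1.aestronglyMeasurable C (ae_of_all _ hC)

lemma integrable_comp (hf : IsBoundedMeasurable f) {μ : Measure β} [IsFiniteMeasure μ]
    {W : β → α} (hW : AEMeasurable W μ) : Integrable (fun b => f (W b)) μ :=
  let ⟨C, hC⟩ := hf.2
  .of_bound (hf.1.comp_aemeasurable hW).aestronglyMeasurable C (ae_of_all _ fun b => hC (W b))

lemma tendsto_integral_comp [TopologicalSpace α] (hf : IsBoundedMeasurable f)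
    (hfc : Continuous f) {μ : Measure β} [IsFiniteMeasure μ] {Y : ℕ → β → α} {Y' : β → α}
    (hY : ∀ n, AEMeasurable (Y n) μ)
    (hlim : ∀ᵐ b ∂μ, Tendsto (fun n => Y n b) atTop (𝓝 (Y' b))) :
    Tendsto (fun n => ∫ b, f (Y n b) ∂μ) atTop (𝓝 (∫ b, f (Y' b) ∂μ)) := by
  obtain ⟨C, hC⟩ := hf.2
  refine tendsto_integral_of_dominated_convergence (fun _ => C)
    (fun n => (hf.1.comp_aemeasurable (hY n)).aestronglyMeasurable) (integrable_const C)
    (fun n => ae_of_all _ fun b => hC (Y n b)) ?_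
  filter_upwards [hlim] with b hb using (hfc.tendsto _).comp hb

end IsBoundedMeasurable

section Markov

lemma integral_mul_eq_of_disintegration {Ω α β : Type*} [MeasurableSpace Ω] {P : Measure Ω}
    [IsFiniteMeasure P] {mα : MeasurableSpace α} [MeasurableSpace β] {a : Ω → α} {b : Ω → β}
    (ha : Measurable a) (hb : Measurable b) (κ : Kernel α β) [IsMarkovKernel κ]
    (h : ∀ G A, MeasurableSet G → MeasurableSet A →
      P (a ⁻¹' G ∩ b ⁻¹' A) = ∫⁻ ω in a ⁻¹' G, κ (a ω) A ∂P)
    {W : α → ℝ} (hW : IsBoundedMeasurable W) {F : β → ℝ} (hF : IsBoundedMeasurable F) :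
    ∫ ω, W (a ω) * F (b ω) ∂P = ∫ ω, W (a ω) * ∫ y, F y ∂κ (a ω) ∂P := by
  have hlaw : P.map (fun ω => (a ω, b ω)) = (P.map a) ⊗ₘ κ := by
    refine Measure.ext_prod fun {G A} hG hA => ?_
    rw [Measure.map_apply (ha.prodMk hb) (hG.prod hA), Measure.compProd_apply_prod hG hA,
      setLIntegral_map hG (κ.measurable_coe hA) ha, ← h G A hG hA]
    rfl
  have hWF : IsBoundedMeasurable fun p : α × β => W p.1 * F p.2 :=
    (hW.comp measurable_fst).mul (hF.comp measurable_snd)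
  calc ∫ ω, W (a ω) * F (b ω) ∂P
      = ∫ p, W p.1 * F p.2 ∂(P.map a) ⊗ₘ κ := by
        rw [← hlaw, integral_map (ha.prodMk hb).aemeasurable hWF.1.aestronglyMeasurable]
    _ = ∫ y, W y * ∫ y', F y' ∂κ y ∂P.map a := by
        rw [Measure.integral_compProd (hWF.integrable _)]
        simp only [integral_const_mul]
    _ = ∫ ω, W (a ω) * ∫ y, F y ∂κ (a ω) ∂P := integral_map ha.aemeasurable
        (hW.1.stronglyMeasurable.mul
          hF.1.stronglyMeasurable.integral_kernel).aestronglyMeasurable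

lemma measurable_of_optional {Ω : Type*} {m : MeasurableSpace Ω} {𝓖 : Filtration ℝ≥0 m}
    {τ : Ω → ℝ≥0} (hτ : ∀ c, MeasurableSet[𝓖 c] {ω | τ ω < c}) : Measurable τ :=
  measurable_of_Iio fun c => 𝓖.le c _ (hτ c)

lemma isStoppingTime_gridAbove {Ω : Type*} {m : MeasurableSpace Ω} {𝓖 : Filtration ℝ≥0 m}
    {τ : Ω → ℝ≥0} (hτ : ∀ c, MeasurableSet[𝓖 c] {ω | τ ω < c}) (n : ℕ) :
    IsStoppingTime 𝓖 fun ω => (gridAbove n (τ ω) : WithTop ℝ≥0) := fun c => by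
  simp only [WithTop.coe_le_coe, gridAbove_le_iff]
  exact 𝓖.mono (div_le_of_le_mul₀ (by positivity) zero_le (Nat.floor_le zero_le)) _ (hτ _)

variable {Ω S : Type*} [mΩ : MeasurableSpace Ω] [MeasurableSpace S] [TopologicalSpace S]
  {P : Measure Ω} {𝓕 : S → Filtration ℝ≥0 mΩ} {X : S → ℝ≥0 → Ω → S}

namespace IsCadlagStrongMarkov

lemma measurable (hX : IsCadlagStrongMarkov P 𝓕 X) (z : S) (t : ℝ≥0) : Measurable (X z t) :=
  (hX.adapted z t).mono ((𝓕 z).le t) le_rfl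

lemma measurable_path (hX : IsCadlagStrongMarkov P 𝓕 X) (z : S) : Measurable fun ω t => X z t ω :=
  measurable_pi_lambda _ fun t => hX.measurable z t

/-- The laws of the paths, as a Markov kernel from the start point to the path space. -/
noncomputable def pathKernel (hX : IsCadlagStrongMarkov P 𝓕 X) : Kernel S (ℝ≥0 → S) :=
  ⟨fun z => pathLaw P (X z), hX.measurable_law⟩

lemma isMarkovKernel_pathKernel [IsProbabilityMeasure P] (hX : IsCadlagStrongMarkov P 𝓕 X) :
    IsMarkovKernel hX.pathKernel :=
  ⟨fun z => Measure.isProbabilityMeasure_map (hX.measurable_path z).aemeasurable⟩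

lemma integral_pathKernel (hX : IsCadlagStrongMarkov P 𝓕 X) (z : S) {F : (ℝ≥0 → S) → ℝ}
    (hF : Measurable F) : ∫ x, F x ∂hX.pathKernel z = ∫ ω, F (fun t => X z t ω) ∂P :=
  integral_map (hX.measurable_path z).aemeasurable hF.aestronglyMeasurable

lemma isBoundedMeasurable_integral [IsProbabilityMeasure P] (hX : IsCadlagStrongMarkov P 𝓕 X)
    {F : (ℝ≥0 → S) → ℝ} (hF : IsBoundedMeasurable F) :
    IsBoundedMeasurable fun z => ∫ ω, F (fun t => X z t ω) ∂P := by
  obtain ⟨hFm, C, hC⟩ := hF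
  refine ⟨?_, C, fun z => ?_⟩
  · simpa only [hX.integral_pathKernel _ hFm] using
      (hFm.stronglyMeasurable.integral_kernel (κ := hX.pathKernel)).measurable
  · simpa using norm_integral_le_of_norm_le_const (μ := P) (f := fun ω => F fun t => X z t ω)
      (ae_of_all _ fun ω => hC _)

lemma isBoundedMeasurable_transition [IsProbabilityMeasure P] (hX : IsCadlagStrongMarkov P 𝓕 X)
    (u : ℝ≥0) {g : S → ℝ} (hg : IsBoundedMeasurable g) :
    IsBoundedMeasurable (transition P X u g) :=
  hX.isBoundedMeasurable_integral (hg.comp (measurable_pi_apply u))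

lemma integral_mul_shift [IsProbabilityMeasure P] (hX : IsCadlagStrongMarkov P 𝓕 X) (z : S)
    (s : ℝ≥0) {W : Ω → ℝ} (hW : Measurable[𝓕 z s] W) (hWC : ∃ C, ∀ ω, |W ω| ≤ C)
    {F : (ℝ≥0 → S) → ℝ} (hF : IsBoundedMeasurable F) :
    ∫ ω, W ω * F (fun u => X z (s + u) ω) ∂P
      = ∫ ω, W ω * ∫ ω', F (fun u => X (X z s ω) u ω') ∂P ∂P := by
  have := hX.isMarkovKernel_pathKernel
  have hdis : ∀ G A, MeasurableSet[𝓕 z s] G → MeasurableSet A →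
      P (G ∩ (fun ω u => X z (s + u) ω) ⁻¹' A) = ∫⁻ ω in G, hX.pathKernel (X z s ω) A ∂P := by
    intro G A hG hA
    have h := hX.strong_markov z (fun _ => (s : WithTop ℝ≥0)) (isStoppingTime_const _ s) G
      (by rwa [IsStoppingTime.measurableSpace_const]) A hA
    simp only [ne_eq, WithTop.coe_ne_top, not_false_eq_true, true_and, and_true,
      WithTop.untopD_coe, ofPred_mem_eq] at h
    exact h
  have key := integral_mul_eq_of_disintegration (mα := 𝓕 z s) (measurable_id'' ((𝓕 z).le s))
    (measurable_pi_lambda _ fun u => hX.measurable z (s + u))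
    (Kernel.comap (mγ := 𝓕 z s) hX.pathKernel (X z s) (hX.adapted z s)) hdis ⟨hW, hWC⟩ hF
  simpa only [id, Kernel.comap_apply, hX.integral_pathKernel _ hF.1] using key

lemma integral_shift_stoppingTime [IsProbabilityMeasure P] (hX : IsCadlagStrongMarkov P 𝓕 X)
    (z : S) {τ : Ω → ℝ≥0} (hτ : IsStoppingTime (𝓕 z) fun ω => (τ ω : WithTop ℝ≥0))
    (hXτ : ∀ u, Measurable fun ω => X z (τ ω + u) ω) {F : (ℝ≥0 → S) → ℝ}
    (hF : IsBoundedMeasurable F) :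
    ∫ ω, F (fun u => X z (τ ω + u) ω) ∂P
      = ∫ ω, ∫ ω', F (fun u => X (X z (τ ω) ω) u ω') ∂P ∂P := by
  have := hX.isMarkovKernel_pathKernel
  have hX₀ : Measurable fun ω => X z (τ ω) ω := by simpa only [add_zero] using hXτ 0
  have hshift : Measurable fun ω u => X z (τ ω + u) ω := measurable_pi_lambda _ hXτ
  have hlaw : P.map (fun ω u => X z (τ ω + u) ω)
      = hX.pathKernel ∘ₘ P.map fun ω => X z (τ ω) ω := by
    ext A hA
    rw [Measure.map_apply hshift hA, Measure.bind_apply hA hX.pathKernel.aemeasurable,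
      lintegral_map (hX.pathKernel.measurable_coe hA) hX₀]
    have h := hX.strong_markov z _ hτ univ MeasurableSet.univ A hA
    simp only [mem_univ, ne_eq, WithTop.coe_ne_top, not_false_eq_true, true_and,
      WithTop.untopD_coe, ofPred_true, Measure.restrict_univ] at h
    exact h
  calc ∫ ω, F (fun u => X z (τ ω + u) ω) ∂P
      = ∫ x, F x ∂(hX.pathKernel ∘ₘ P.map fun ω => X z (τ ω) ω) := by
        rw [← hlaw, integral_map hshift.aemeasurable hF.1.aestronglyMeasurable]
    _ = ∫ y, ∫ x, F x ∂hX.pathKernel y ∂P.map fun ω => X z (τ ω) ω := by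
        rw [← Measure.snd_compProd, Measure.snd, integral_map measurable_snd.aemeasurable
          hF.1.aestronglyMeasurable, Measure.integral_compProd
          ((hF.comp measurable_snd).integrable _)]
    _ = ∫ ω, ∫ ω', F (fun u => X (X z (τ ω) ω) u ω') ∂P ∂P := by
        simp only [hX.integral_pathKernel _ hF.1]
        exact integral_map hX₀.aemeasurable
          (hX.isBoundedMeasurable_integral hF).1.aestronglyMeasurable

lemma ae_tendsto_gridAbove (hX : IsCadlagStrongMarkov P 𝓕 X) (z : S) (τ : Ω → ℝ≥0) (u : ℝ≥0) :
    ∀ᵐ ω ∂P, Tendsto (fun n => X z (gridAbove n (τ ω) + u) ω) atTop (𝓝 (X z (τ ω + u) ω)) := by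
  filter_upwards [hX.cadlag z] with ω hω
  exact hω.tendsto_of_ge (fun n => add_le_add_left (le_gridAbove n (τ ω)) u)
    ((tendsto_gridAbove (τ ω)).add_const u)

lemma measurable_gridAbove (hX : IsCadlagStrongMarkov P 𝓕 X) (z : S) {τ : Ω → ℝ≥0}
    (hτ : Measurable τ) (n : ℕ) (u : ℝ≥0) :
    Measurable fun ω => X z (gridAbove n (τ ω) + u) ω :=
  measurable_comp_gridAbove (fun v => hX.measurable z (v + u)) hτ n

lemma aemeasurable_at_time [TopologicalSpace.PseudoMetrizableSpace S] [BorelSpace S]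
    (hX : IsCadlagStrongMarkov P 𝓕 X) (z : S) {τ : Ω → ℝ≥0} (hτ : Measurable τ) (u : ℝ≥0) :
    AEMeasurable (fun ω => X z (τ ω + u) ω) P :=
  aemeasurable_of_tendsto_metrizable_ae atTop
    (fun n => (hX.measurable_gridAbove z hτ n u).aemeasurable) (hX.ae_tendsto_gridAbove z τ u)

/-- The strong Markov property at a time `τ` of which only `{τ < c}` is adapted: continuity of
`transition P X u g` allows to approximate `τ` by stopping times from above. -/
lemma integral_optional [IsProbabilityMeasure P] (hX : IsCadlagStrongMarkov P 𝓕 X) (z : S)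
    {τ : Ω → ℝ≥0} (hτ : ∀ c, MeasurableSet[𝓕 z c] {ω | τ ω < c}) (u : ℝ≥0) {g : S → ℝ}
    (hg : IsBoundedMeasurable g) (hgc : Continuous g) (hUg : Continuous (transition P X u g)) :
    ∫ ω, g (X z (τ ω + u) ω) ∂P = ∫ ω, transition P X u g (X z (τ ω) ω) ∂P := by
  have hτm := measurable_of_optional hτ
  have hlim : ∀ {h : S → ℝ}, IsBoundedMeasurable h → Continuous h → ∀ v,
      Tendsto (fun n => ∫ ω, h (X z (gridAbove n (τ ω) + v) ω) ∂P) atTop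
        (𝓝 (∫ ω, h (X z (τ ω + v) ω) ∂P)) := fun hh hhc v =>
    hh.tendsto_integral_comp hhc (fun n => (hX.measurable_gridAbove z hτm n v).aemeasurable)
      (hX.ae_tendsto_gridAbove z τ v)
  have hgrid : ∀ n, ∫ ω, g (X z (gridAbove n (τ ω) + u) ω) ∂P
      = ∫ ω, transition P X u g (X z (gridAbove n (τ ω)) ω) ∂P := fun n =>
    hX.integral_shift_stoppingTime z (isStoppingTime_gridAbove hτ n)
      (fun v => hX.measurable_gridAbove z hτm n v) (hg.comp (measurable_pi_apply u))
  have hlimU := hlim (hX.isBoundedMeasurable_transition u hg) hUg 0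
  simp only [add_zero] at hlimU
  exact tendsto_nhds_unique (hlim hg hgc u) (hlimU.congr fun n => (hgrid n).symm)

end IsCadlagStrongMarkov

end Markov

/-- The strong Feller property `[SF]` of a semigroup `Q`: at positive times it maps bounded Borel
functions to continuous ones. -/
def IsStrongFeller {S : Type*} [MeasurableSpace S] [TopologicalSpace S]
    (Q : ℝ≥0 → (S → ℝ) → S → ℝ) : Prop :=
  ∀ t, 0 < t → ∀ f, IsBoundedMeasurable f → Continuous (Q t f)

section QuasiLeftContinuity

lemma abs_transition_le {Ω S : Type*} [MeasurableSpace Ω] {P : Measure Ω} [IsProbabilityMeasure P]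
    {X : S → ℝ≥0 → Ω → S} {g : S → ℝ} {C : ℝ} (hC : ∀ y, |g y| ≤ C) (u : ℝ≥0) (y : S) :
    |transition P X u g y| ≤ C := by
  simpa [transition] using norm_integral_le_of_norm_le_const (μ := P) (f := fun ω => g (X y u ω))
    (ae_of_all _ fun ω => hC _)

lemma IsCadlag.tendsto_of_tendsto_add {S : Type*} [TopologicalSpace S] [RegularSpace S]
    {x : ℝ≥0 → S} (hx : IsCadlag x) {T : ℕ → ℝ≥0} {t : ℝ≥0} (hT : Tendsto T atTop (𝓝 t))
    {u : ℕ → ℝ≥0} (hu₀ : ∀ m, 0 < u m) (hu : Tendsto u atTop (𝓝 0)) {y : ℕ → S}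
    (hy : ∀ m, Tendsto (fun n => x (T n + u m)) atTop (𝓝 (y m))) : Tendsto y atTop (𝓝 (x t)) := by
  refine (closed_nhds_basis (x t)).tendsto_right_iff.2 fun W ⟨hW, hWc⟩ => ?_
  obtain ⟨b, hb, hsub⟩ := mem_nhdsGE_iff_exists_Ico_subset.1 ((hx t).1 hW)
  have hub : ∀ᶠ m in atTop, t + u m < b :=
    (hu.const_add t).eventually (gt_mem_nhds (by simpa using hb))
  filter_upwards [hub] with m hm
  have hmem : ∀ᶠ n in atTop, T n + u m ∈ Ioo t b :=
    (hT.add_const (u m)).eventually (Ioo_mem_nhds (lt_add_of_pos_right t (hu₀ m)) hm)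
  exact hWc.mem_of_tendsto (hy m) (hmem.mono fun n hn => hsub (Ioo_subset_Ico_self hn))

variable {Ω S : Type*} [mΩ : MeasurableSpace Ω] [MeasurableSpace S] [PseudoMetricSpace S]
  {P : Measure Ω} {𝓕 : S → Filtration ℝ≥0 mΩ} {X : S → ℝ≥0 → Ω → S} {g : S → ℝ}

namespace IsCadlagStrongMarkov

lemma exists_ae_tendsto_of_monotone (hX : IsCadlagStrongMarkov P 𝓕 X) (z : S)
    {T : ℕ → Ω → ℝ≥0} {T' : Ω → ℝ≥0} (hmono : ∀ ω, Monotone fun n => T n ω)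
    (hlim : ∀ ω, Tendsto (fun n => T n ω) atTop (𝓝 (T' ω))) (u : ℝ≥0) :
    ∃ L : Ω → S, ∀ᵐ ω ∂P, Tendsto (fun n => X z (T n ω + u) ω) atTop (𝓝 (L ω)) := by
  have : Nonempty S := ⟨z⟩
  choose! L hL using fun ω (hω : IsCadlag fun t => X z t ω) =>
    hω.exists_tendsto_of_monotone ((hmono ω).add_const u) ((hlim ω).add_const u)
  exact ⟨L, (hX.cadlag z).mono hL⟩

lemma tendsto_transition_zero [OpensMeasurableSpace S] [IsProbabilityMeasure P]
    (hX : IsCadlagStrongMarkov P 𝓕 X) (hg : IsBoundedMeasurable g) (hgc : Continuous g)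
    {u : ℕ → ℝ≥0} (hu : Tendsto u atTop (𝓝 0)) (y : S) :
    Tendsto (fun m => transition P X (u m) g y) atTop (𝓝 (g y)) := by
  have hlim : ∀ᵐ ω ∂P, Tendsto (fun m => X y (u m) ω) atTop (𝓝 y) := by
    filter_upwards [hX.cadlag y, hX.start y] with ω hω h₀
    simpa only [h₀] using hω.tendsto_of_ge (fun _ => zero_le) hu
  simpa only [transition, integral_const, probReal_univ, one_smul] using
    hg.tendsto_integral_comp hgc (fun m => (hX.measurable y (u m)).aemeasurable) hlim

variable [BorelSpace S] [IsProbabilityMeasure P]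

lemma integral_eq_integral_transition_of_tendsto (hX : IsCadlagStrongMarkov P 𝓕 X) (z : S)
    {T : ℕ → Ω → ℝ≥0} (hT : ∀ n c, MeasurableSet[𝓕 z c] {ω | T n ω < c}) {u : ℝ≥0} {L L' : Ω → S}
    (hL : ∀ᵐ ω ∂P, Tendsto (fun n => X z (T n ω) ω) atTop (𝓝 (L ω)))
    (hL' : ∀ᵐ ω ∂P, Tendsto (fun n => X z (T n ω + u) ω) atTop (𝓝 (L' ω)))
    (hg : IsBoundedMeasurable g) (hgc : Continuous g) (hUg : Continuous (transition P X u g)) :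
    ∫ ω, g (L' ω) ∂P = ∫ ω, transition P X u g (L ω) ∂P := by
  have hmeas := fun n v => hX.aemeasurable_at_time z (measurable_of_optional (hT n)) v
  refine tendsto_nhds_unique (hg.tendsto_integral_comp hgc (fun n => hmeas n u) hL') ?_
  simp only [hX.integral_optional z (hT _) u hg hgc hUg]
  exact (hX.isBoundedMeasurable_transition u hg).tendsto_integral_comp hUg
    (fun n => by simpa only [add_zero] using hmeas n 0) hL

/-- Quasi-left-continuity in integrated form: a path does not jump at a limit of increasing
optional times. Applying the Markov property a little after `T n` and letting the delay tend to
`0` after `n → ∞` turns the left limit into the value at the limit time. -/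
lemma integral_leftLimit_eq (hX : IsCadlagStrongMarkov P 𝓕 X)
    (hSF : IsStrongFeller (transition P X)) (z : S) {T : ℕ → Ω → ℝ≥0} {T' : Ω → ℝ≥0}
    (hT : ∀ n c, MeasurableSet[𝓕 z c] {ω | T n ω < c}) (hmono : ∀ ω, Monotone fun n => T n ω)
    (hlim : ∀ ω, Tendsto (fun n => T n ω) atTop (𝓝 (T' ω))) {L : Ω → S}
    (hL : ∀ᵐ ω ∂P, Tendsto (fun n => X z (T n ω) ω) atTop (𝓝 (L ω)))
    (hg : IsBoundedMeasurable g) (hgc : Continuous g) :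
    ∫ ω, g (L ω) ∂P = ∫ ω, g (X z (T' ω) ω) ∂P := by
  set u : ℕ → ℝ≥0 := fun m => 1 / (m + 1)
  have hu₀ : ∀ m, 0 < u m := fun m => by positivity
  have hu : Tendsto u atTop (𝓝 0) := tendsto_one_div_add_atTop_nhds_zero_nat
  have hmeas := fun n v => hX.aemeasurable_at_time z (measurable_of_optional (hT n)) v
  choose L' hL' using fun m => hX.exists_ae_tendsto_of_monotone z hmono hlim (u m)
  have hLm : AEMeasurable L P := aemeasurable_of_tendsto_metrizable_ae atTop
    (fun n => by simpa only [add_zero] using hmeas n 0) hL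
  have hleft : Tendsto (fun m => ∫ ω, transition P X (u m) g (L ω) ∂P) atTop
      (𝓝 (∫ ω, g (L ω) ∂P)) := by
    obtain ⟨C, hC⟩ := hg.2
    refine tendsto_integral_of_dominated_convergence (fun _ => C)
      (fun m => ((hX.isBoundedMeasurable_transition (u m) hg).1.comp_aemeasurable
        hLm).aestronglyMeasurable) (integrable_const C)
      (fun m => ae_of_all _ fun ω => abs_transition_le hC (u m) (L ω))
      (ae_of_all _ fun ω => hX.tendsto_transition_zero hg hgc hu (L ω))
  have hright : Tendsto (fun m => ∫ ω, g (L' m ω) ∂P) atTop (𝓝 (∫ ω, g (X z (T' ω) ω) ∂P)) := by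
    refine hg.tendsto_integral_comp hgc (fun m =>
      aemeasurable_of_tendsto_metrizable_ae atTop (fun n => hmeas n (u m)) (hL' m)) ?_
    filter_upwards [hX.cadlag z, ae_all_iff.2 hL'] with ω hω hω'
    exact hω.tendsto_of_tendsto_add (hlim ω) hu₀ hu hω'
  exact tendsto_nhds_unique hleft (hright.congr fun m =>
    hX.integral_eq_integral_transition_of_tendsto z hT hL (hL' m) hg hgc (hSF _ (hu₀ m) g hg))

/-- By quasi-left-continuity, the path is in the zero set of `φ` at the first time by which it has
come arbitrarily close to it. -/
lemma ae_exists_eq_zero (hX : IsCadlagStrongMarkov P 𝓕 X) (hSF : IsStrongFeller (transition P X))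
    {φ : S → ℝ} (hφ : Continuous φ) (hφ₀ : ∀ y, 0 ≤ φ y) (z : S) (t : ℝ≥0) :
    ∀ᵐ ω ∂P, (fun s => φ (X z s ω)) ∉ survival t → ∃ s ≤ t, φ (X z s ω) = 0 := by
  set T : ℕ → Ω → ℝ≥0 := fun n ω => entry (1 / ((n : ℝ) + 1)) t fun s => φ (X z s ω)
  set T' : Ω → ℝ≥0 := fun ω => approachTime t fun s => φ (X z s ω)
  have hT : ∀ n c, MeasurableSet[𝓕 z c] {ω | T n ω < c} := fun n c => measurableSet_entry_lt
    (fun u hu => hφ.measurable.comp ((hX.adapted z u).mono ((𝓕 z).mono hu.le) le_rfl)) _ t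
  have hTm : ∀ n, Measurable (T n) := fun n => measurable_of_optional (hT n)
  have hmono : ∀ ω, Monotone fun n => T n ω := fun ω => monotone_entry t _
  have hlim : ∀ ω, Tendsto (fun n => T n ω) atTop (𝓝 (T' ω)) := fun ω => tendsto_entry t _
  obtain ⟨L, hL⟩ := hX.exists_ae_tendsto_of_monotone z hmono hlim 0
  have hLm : AEMeasurable L P := aemeasurable_of_tendsto_metrizable_ae atTop
    (fun n => hX.aemeasurable_at_time z (hTm n) 0) hL
  have hT'm : AEMeasurable (fun ω => X z (T' ω) ω) P := by
    simpa only [add_zero] using hX.aemeasurable_at_time z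
      (measurable_of_tendsto_metrizable hTm (tendsto_pi_nhds.2 hlim)) 0
  simp only [add_zero] at hL
  have hφL : ∀ᵐ ω ∂P, φ (L ω) ≤ φ (X z (T' ω) ω) ∧
      ((fun s => φ (X z s ω)) ∉ survival t → φ (L ω) = 0) := by
    filter_upwards [hL, hX.cadlag z] with ω hω hc
    have hφω := (hφ.tendsto _).comp hω
    exact ⟨(hc.comp hφ).le_apply_approachTime (fun s => hφ₀ _) hφω,
      fun hs => ((hc.comp hφ).le_zero_of_tendsto_entry hs hφω).antisymm (hφ₀ _)⟩
  set g : S → ℝ := fun y => min (φ y) 1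
  have hgc : Continuous g := hφ.min continuous_const
  have hg : IsBoundedMeasurable g := ⟨hgc.measurable, 1, fun y =>
    (abs_of_nonneg (le_min (hφ₀ y) zero_le_one)).trans_le (min_le_right _ _)⟩
  have hgL : (fun ω => g (L ω)) =ᵐ[P] fun ω => g (X z (T' ω) ω) :=
    (integral_eq_iff_of_ae_le (hg.integrable_comp hLm) (hg.integrable_comp hT'm)
      (hφL.mono fun ω h => min_le_min_right 1 h.1)).1
      (hX.integral_leftLimit_eq hSF z hT hmono hlim hL hg hgc)
  filter_upwards [hgL, hφL] with ω hω h hs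
  refine ⟨T' ω, approachTime_le t _, ?_⟩
  have hmin : min (φ (X z (T' ω) ω)) 1 = 0 := by simpa [g, h.2 hs] using hω.symm
  exact (min_eq_iff.1 hmin).elim And.left fun h₁ => absurd h₁.1 one_ne_zero

end IsCadlagStrongMarkov

end QuasiLeftContinuity

section ExitTime

lemma exists_continuous_eq_zero_iff {S : Type*} [PseudoMetricSpace S] {D : Set S} (hD : IsOpen D) :
    ∃ φ : S → ℝ, Continuous φ ∧ (∀ y, 0 ≤ φ y) ∧ ∀ y, φ y = 0 ↔ y ∉ D := by
  rcases Dᶜ.eq_empty_or_nonempty with h | h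
  · refine ⟨fun _ => 1, continuous_const, fun _ => zero_le_one, fun y => ?_⟩
    simp [compl_empty_iff.1 h]
  · exact ⟨fun y => Metric.infDist y Dᶜ, Metric.continuous_infDist_pt _,
      fun _ => Metric.infDist_nonneg, fun _ => (hD.isClosed_compl.mem_iff_infDist_zero h).symm⟩

lemma IsCadlag.lt_exitTime_iff {Ω S : Type*} [TopologicalSpace S] {X : S → ℝ≥0 → Ω → S} {D : Set S}
    (hD : IsOpen D) {z : S} {ω : Ω} (hω : IsCadlag fun t => X z t ω) (t : ℝ≥0) :
    (t : WithTop ℝ≥0) < exitTime X D z ω ↔ ∀ s ≤ t, X z s ω ∈ D := by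
  refine ⟨fun h s hs => not_not.1
    (notMem_of_lt_hittingAfter ((WithTop.coe_le_coe.2 hs).trans_lt h) zero_le), fun h => ?_⟩
  obtain ⟨b, hb, hsub⟩ := mem_nhdsGE_iff_exists_Ico_subset.1
    ((hω t).1.eventually (hD.mem_nhds (h t le_rfl)))
  refine (WithTop.coe_lt_coe.2 hb).trans_le (not_lt.1 fun hlt => ?_)
  obtain ⟨s, hs, hsD⟩ := hittingAfter_lt_iff.1 hlt
  exact hsD ((le_total s t).elim (h s) fun hts => hsub ⟨hts, hs.2⟩)

lemma IsCadlagStrongMarkov.ae_lt_exitTime_iff {Ω S : Type*} [mΩ : MeasurableSpace Ω]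
    [MeasurableSpace S] [PseudoMetricSpace S] [BorelSpace S] {P : Measure Ω}
    [IsProbabilityMeasure P] {𝓕 : S → Filtration ℝ≥0 mΩ} {X : S → ℝ≥0 → Ω → S}
    (hX : IsCadlagStrongMarkov P 𝓕 X) (hSF : IsStrongFeller (transition P X)) {D : Set S}
    {φ : S → ℝ} (hφ : Continuous φ) (hφ₀ : ∀ y, 0 ≤ φ y) (hφD : ∀ y, φ y = 0 ↔ y ∉ D)
    (z : S) (t : ℝ≥0) :
    ∀ᵐ ω ∂P, (t : WithTop ℝ≥0) < exitTime X D z ω ↔ (fun s => φ (X z s ω)) ∈ survival t := by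
  have hD : IsOpen D := by
    convert (isOpen_compl_singleton (x := (0 : ℝ))).preimage hφ
    ext y
    simp [hφD]
  filter_upwards [hX.cadlag z, hX.ae_exists_eq_zero hSF hφ hφ₀ z t] with ω hω hhit
  rw [hω.lt_exitTime_iff hD]
  constructor
  · intro h
    by_contra hs
    obtain ⟨s, hst, h₀⟩ := hhit hs
    exact (hφD _).1 h₀ (h s hst)
  · intro hs s hst
    obtain ⟨δ, hδ, hle⟩ := ((hω.comp hφ).mem_survival_iff t).1 hs
    exact not_not.1 fun hsD => (hδ.trans_le (hle s hst)).ne' ((hφD _).2 hsD)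

end ExitTime

section StrongFeller

section Setwise

variable {Ω S : Type*} [MeasurableSpace Ω] {P : Measure Ω} [IsFiniteMeasure P]
  [MeasurableSpace S] {f g : S → ℝ} {Y : ℕ → Ω → S} {Y' : Ω → S}

lemma integral_abs_sub_comp_le (hf : IsBoundedMeasurable f) (hg : IsBoundedMeasurable g)
    {W W' : Ω → S} (hW : AEMeasurable W P) (hW' : AEMeasurable W' P) :
    ∫ ω, |f (W ω) - f (W' ω)| ∂P ≤ ∫ ω, |f (W ω) - g (W ω)| ∂P
      + ∫ ω, |g (W ω) - g (W' ω)| ∂P + ∫ ω, |f (W' ω) - g (W' ω)| ∂P := by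
  have hdiff : ∀ {h : S → ℝ}, IsBoundedMeasurable h →
      Integrable (fun ω => |h (W ω) - h (W' ω)|) P := fun hh =>
    ((hh.integrable_comp hW).sub (hh.integrable_comp hW')).abs
  have h₁ := (hf.abs_sub hg).integrable_comp hW
  have h₂ := (hf.abs_sub hg).integrable_comp hW'
  have hsum := (integral_add (h₁.add (hdiff hg)) h₂).trans
    (congrArg (· + _) (integral_add h₁ (hdiff hg)))
  refine (integral_mono (hdiff hf) ((h₁.add (hdiff hg)).add h₂) fun ω => ?_).trans_eq hsum
  calc |f (W ω) - f (W' ω)|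
      = |f (W ω) - g (W ω) + (g (W ω) - g (W' ω)) + (g (W' ω) - f (W' ω))| := by ring_nf
    _ ≤ |f (W ω) - g (W ω)| + |g (W ω) - g (W' ω)| + |g (W' ω) - f (W' ω)| := abs_add_three _ _ _
    _ = |f (W ω) - g (W ω)| + |g (W ω) - g (W' ω)| + |f (W' ω) - g (W' ω)| := by
      rw [abs_sub_comm (f (W' ω))]

variable [TopologicalSpace S] [TopologicalSpace.PseudoMetrizableSpace S] [BorelSpace S]

lemma exists_continuous_integral_abs_sub_comp_le (hf : IsBoundedMeasurable f)
    (hY' : AEMeasurable Y' P) {ε : ℝ} (hε : 0 < ε) :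
    ∃ g : S → ℝ, IsBoundedMeasurable g ∧ Continuous g ∧ ∫ ω, |f (Y' ω) - g (Y' ω)| ∂P ≤ ε := by
  obtain ⟨g, hg, -⟩ := (hf.integrable (P.map Y')).exists_boundedContinuous_integral_sub_le hε
  have hgb : IsBoundedMeasurable g :=
    ⟨g.continuous.measurable, ‖g‖, fun y => g.norm_coe_le_norm y⟩
  exact ⟨g, hgb, g.continuous,
    (integral_map hY' (hf.abs_sub hgb).1.aestronglyMeasurable).symm.trans_le hg⟩

/-- Almost sure convergence handles continuous functions, and setwise convergence of the laws makes
the error of an approximation in `L¹` of `f` by a continuous function uniform in `n`. -/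
lemma tendsto_integral_abs_sub_comp (hY : ∀ n, AEMeasurable (Y n) P) (hY' : AEMeasurable Y' P)
    (hlim : ∀ᵐ ω ∂P, Tendsto (fun n => Y n ω) atTop (𝓝 (Y' ω)))
    (hset : ∀ h : S → ℝ, IsBoundedMeasurable h →
      Tendsto (fun n => ∫ ω, h (Y n ω) ∂P) atTop (𝓝 (∫ ω, h (Y' ω) ∂P)))
    (hf : IsBoundedMeasurable f) :
    Tendsto (fun n => ∫ ω, |f (Y n ω) - f (Y' ω)| ∂P) atTop (𝓝 0) := by
  refine tendsto_order.2 ⟨fun a ha => Eventually.of_forall fun n =>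
    ha.trans_le (integral_nonneg fun _ => abs_nonneg _), fun ε hε => ?_⟩
  obtain ⟨g, hg, hgc, hfg⟩ :=
    exists_continuous_integral_abs_sub_comp_le hf hY' (by positivity : 0 < ε / 3)
  have hgY : Tendsto (fun n => ∫ ω, |g (Y n ω) - g (Y' ω)| ∂P) atTop (𝓝 0) := by
    have hpair : ∀ᵐ ω ∂P, Tendsto (fun n => (Y n ω, Y' ω)) atTop (𝓝 (Y' ω, Y' ω)) :=
      hlim.mono fun ω hω => hω.prodMk_nhds tendsto_const_nhds
    simpa only [sub_self, abs_zero, integral_zero] using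
      ((hg.comp measurable_fst).abs_sub (hg.comp measurable_snd)).tendsto_integral_comp
        (by fun_prop) (fun n => (hY n).prodMk hY') hpair
  have hbound := ((hset _ (hf.abs_sub hg)).add hgY).add_const (∫ ω, |f (Y' ω) - g (Y' ω)| ∂P)
  filter_upwards [hbound.eventually (gt_mem_nhds (by linarith : _ < ε))] with n hn
  exact (integral_abs_sub_comp_le hf hg (hY n) hY').trans_lt hn

lemma tendsto_integral_comp_mul (hY : ∀ n, AEMeasurable (Y n) P) (hY' : AEMeasurable Y' P)
    (hlim : ∀ᵐ ω ∂P, Tendsto (fun n => Y n ω) atTop (𝓝 (Y' ω)))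
    (hset : ∀ h : S → ℝ, IsBoundedMeasurable h →
      Tendsto (fun n => ∫ ω, h (Y n ω) ∂P) atTop (𝓝 (∫ ω, h (Y' ω) ∂P)))
    (hf : IsBoundedMeasurable f) {W : ℕ → Ω → ℝ} {W' : Ω → ℝ} {K : ℝ}
    (hW : ∀ n, AEStronglyMeasurable (W n) P) (hWK : ∀ n ω, |W n ω| ≤ K)
    (hWlim : ∀ᵐ ω ∂P, Tendsto (fun n => W n ω) atTop (𝓝 (W' ω))) :
    Tendsto (fun n => ∫ ω, f (Y n ω) * W n ω ∂P) atTop (𝓝 (∫ ω, f (Y' ω) * W' ω ∂P)) := by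
  have hfY := hf.integrable_comp hY'
  have hmul : ∀ {h : Ω → ℝ}, Integrable h P → ∀ n, Integrable (fun ω => h ω * W n ω) P :=
    fun hh n => hh.mul_bdd (hW n) (ae_of_all _ (hWK n))
  have hdom : Tendsto (fun n => ∫ ω, f (Y' ω) * W n ω ∂P) atTop (𝓝 (∫ ω, f (Y' ω) * W' ω ∂P)) := by
    refine tendsto_integral_of_dominated_convergence (fun ω => |f (Y' ω)| * K)
      (fun n => (hmul hfY n).aestronglyMeasurable) (hfY.abs.mul_const K)
      (fun n => ae_of_all _ fun ω => ?_) (hWlim.mono fun ω hω => hω.const_mul _)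
    rw [norm_mul]
    exact mul_le_mul_of_nonneg_left (hWK n ω) (norm_nonneg _)
  have hdiff : Tendsto (fun n => ∫ ω, f (Y n ω) * W n ω ∂P - ∫ ω, f (Y' ω) * W n ω ∂P) atTop
      (𝓝 0) := by
    have hL₁ := (tendsto_integral_abs_sub_comp hY hY' hlim hset hf).mul_const K
    rw [zero_mul] at hL₁
    refine squeeze_zero_norm (fun n => ?_) hL₁
    have hfYn := hf.integrable_comp (hY n)
    rw [← integral_sub (hmul hfYn n) (hmul hfY n), ← integral_mul_const]
    refine norm_integral_le_of_norm_le ((hfYn.sub hfY).abs.mul_const K) (ae_of_all _ fun ω => ?_)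
    rw [← sub_mul, norm_mul]
    exact mul_le_mul_of_nonneg_left (hWK n ω) (norm_nonneg _)
  simpa only [sub_add_cancel, zero_add] using hdiff.add hdom

end Setwise

variable {Ω S : Type*} [mΩ : MeasurableSpace Ω] [MeasurableSpace S] [PseudoMetricSpace S]
  {P : Measure Ω} {𝓕 : S → Filtration ℝ≥0 mΩ} {X : S → ℝ≥0 → Ω → S} {V : S → ℝ} {c : ℝ}

namespace IsCadlagStrongMarkov

lemma ae_exp_neg_potentialIntegral_eq (hX : IsCadlagStrongMarkov P 𝓕 X) (hV : Continuous V)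
    (hc : ∀ y, -c ≤ V y) (z : S) (t : ℝ≥0) :
    ∀ᵐ ω ∂P, Real.exp (-potentialIntegral X V z t ω) = weight c t fun s => V (X z s ω) := by
  filter_upwards [hX.cadlag z] with ω hω
  exact ((hω.comp hV).weight_eq (fun s => hc _) t).symm

lemma feynmanKac_eq (hX : IsCadlagStrongMarkov P 𝓕 X) (hV : Continuous V)
    (hc : ∀ y, -c ≤ V y) (t : ℝ≥0) (f : S → ℝ) (z : S) :
    feynmanKac P X V t f z = ∫ ω, f (X z t ω) * weight c t (fun s => V (X z s ω)) ∂P :=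
  integral_congr_ae <| (hX.ae_exp_neg_potentialIntegral_eq hV hc z t).mono fun _ hω =>
    congrArg _ hω

lemma isStrongFeller_feynmanKac [BorelSpace S] [IsFiniteMeasure P]
    (hX : IsCadlagStrongMarkov P 𝓕 X) (hV : Continuous V) (hc : ∀ y, -c ≤ V y)
    (hSF : IsStrongFeller (transition P X))
    (hP : ∀ (t : ℝ≥0) (z : S), TendstoInMeasure P (fun z' => X z' t) (𝓝 z) (X z t))
    (hIV : ∀ (t : ℝ≥0) (z : S) (zs : ℕ → S), Tendsto zs atTop (𝓝 z) →
      TendstoInMeasure P (fun n => potentialIntegral X V (zs n) t) atTop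
        (potentialIntegral X V z t)) :
    IsStrongFeller (feynmanKac P X V) := by
  refine fun t ht f hf => continuous_iff_continuousAt.2 fun z =>
    tendsto_of_subseq_tendsto fun ns hns => ?_
  obtain ⟨ms, hms, hXlim⟩ :=
    TendstoInMeasure.exists_seq_tendsto_ae fun ε hε => (hP t z ε hε).comp hns
  obtain ⟨ks, hks, hIlim⟩ :=
    (hIV t z (ns ∘ ms) (hns.comp hms.tendsto_atTop)).exists_seq_tendsto_ae
  have hzs : Tendsto (fun n => ns (ms (ks n))) atTop (𝓝 z) :=
    (hns.comp hms.tendsto_atTop).comp hks.tendsto_atTop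
  refine ⟨fun n => ms (ks n), ?_⟩
  simp only [hX.feynmanKac_eq hV hc]
  refine tendsto_integral_comp_mul (fun n => (hX.measurable _ t).aemeasurable)
    (hX.measurable z t).aemeasurable
    (hXlim.mono fun ω hω => hω.comp hks.tendsto_atTop)
    (fun h hh => ((hSF t ht h hh).tendsto z).comp hzs) hf
    (fun n => (measurable_weight (fun u _ => hV.measurable.comp (hX.measurable _ u))
      c).aestronglyMeasurable)
    (fun n ω => abs_weight_le c t _) ?_
  filter_upwards [hIlim, hX.ae_exp_neg_potentialIntegral_eq hV hc z t,
    ae_all_iff.2 fun n => hX.ae_exp_neg_potentialIntegral_eq hV hc (ns (ms (ks n))) t]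
    with ω hω hexp hexps
  simpa only [← hexp, ← hexps, Function.comp_def] using (Real.continuous_exp.tendsto _).comp hω.neg

end IsCadlagStrongMarkov

end StrongFeller

section Killed

lemma IsBoundedMeasurable.extend_subtype {S : Type*} [MeasurableSpace S] {D : Set S}
    (hD : MeasurableSet D) {f : D → ℝ} (hf : IsBoundedMeasurable f) :
    IsBoundedMeasurable (Function.extend Subtype.val f 0) := by
  obtain ⟨hfm, C, hC⟩ := hf
  refine ⟨(MeasurableEmbedding.subtype_coe hD).measurable_extend hfm measurable_zero, max C 0,
    fun y => ?_⟩
  by_cases hy : y ∈ D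
  · rw [Subtype.val_injective.extend_apply f (0 : S → ℝ) ⟨y, hy⟩]
    exact (hC _).trans (le_max_left _ _)
  · rw [Function.extend_apply' f (0 : S → ℝ) y fun ⟨a, ha⟩ => hy (ha ▸ a.2),
      Pi.zero_apply, abs_zero]
    exact le_max_right _ _

section Functional

variable {S : Type*} {V φ f : S → ℝ} {c C : ℝ}

/-- The random variable under the expectation in the killed Feynman–Kac semigroup, as a product
measurable functional of the path. The killing set is the zero set of `φ`. -/
noncomputable def killedFunctional (V : S → ℝ) (c : ℝ) (φ : S → ℝ) (t : ℝ≥0) (f : S → ℝ)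
    (x : ℝ≥0 → S) : ℝ :=
  f (x t) * weight c t (fun s => V (x s)) * (survival t).indicator (fun _ => 1) fun s => φ (x s)

lemma abs_killedFunctional_le (hC : ∀ y, |f y| ≤ C) (t : ℝ≥0) (x : ℝ≥0 → S) :
    |killedFunctional V c φ t f x| ≤ C * Real.exp (c * t) := by
  have hC₀ : 0 ≤ C := (abs_nonneg _).trans (hC (x t))
  have hfw : |f (x t) * weight c t fun s => V (x s)| ≤ C * Real.exp (c * t) := by
    rw [abs_mul]
    exact mul_le_mul (hC _) (abs_weight_le c t _) (abs_nonneg _) hC₀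
  rw [killedFunctional]
  by_cases hx : (fun s => φ (x s)) ∈ survival t
  · simpa [hx] using hfw
  · simpa [hx] using mul_nonneg hC₀ (Real.exp_pos _).le

lemma measurable_killedFunctional [MeasurableSpace S] (hV : Measurable V) (hφ : Measurable φ)
    (hf : Measurable f) (t : ℝ≥0) : Measurable (killedFunctional V c φ t f) :=
  ((hf.comp (measurable_pi_apply t)).mul
    (measurable_weight (fun u _ => hV.comp (measurable_pi_apply u)) c)).mul
    ((measurable_const.indicator (measurableSet_survival t)).comp
      (measurable_pi_lambda _ fun s => hφ.comp (measurable_pi_apply s)))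

lemma isBoundedMeasurable_killedFunctional [MeasurableSpace S] (hV : Measurable V)
    (hφ : Measurable φ) (hf : IsBoundedMeasurable f) (t : ℝ≥0) :
    IsBoundedMeasurable (killedFunctional V c φ t f) :=
  ⟨measurable_killedFunctional hV hφ hf.1 t,
    hf.2.elim fun _ hC => ⟨_, abs_killedFunctional_le hC t⟩⟩

variable [TopologicalSpace S] {x : ℝ≥0 → S}

lemma IsCadlag.killedFunctional_add (hx : IsCadlag x) (hV : Continuous V) (hc : ∀ y, -c ≤ V y)
    (hφ : Continuous φ) (f : S → ℝ) (s u : ℝ≥0) :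
    killedFunctional V c φ (s + u) f x
      = weight c s (fun r => V (x r)) * killedFunctional V c φ u f (fun r => x (s + r))
        * (survival s).indicator (fun _ => 1) fun r => φ (x r) := by
  have hsplit := (hx.comp hφ).mem_survival_add_iff s u
  have hind : (survival (s + u)).indicator (fun _ => (1 : ℝ)) (fun r => φ (x r))
      = (survival s).indicator (fun _ => 1) (fun r => φ (x r))
        * (survival u).indicator (fun _ => 1) fun r => φ (x (s + r)) := by
    by_cases hs : (fun r => φ (x r)) ∈ survival s <;>
      by_cases hu : (fun r => φ (x (s + r))) ∈ survival u <;> simp [hsplit, hs, hu]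
  simp only [killedFunctional, (hx.comp hV).weight_add (fun _ => hc _) s u, hind]
  ring

lemma IsCadlag.abs_killedFunctional_add_sub_le (hx : IsCadlag x) (hV : Continuous V)
    (hc : ∀ y, -c ≤ V y) (hφ : Continuous φ) (hC : ∀ y, |f y| ≤ C) (s u : ℝ≥0) :
    |killedFunctional V c φ (s + u) f x
        - weight c s (fun r => V (x r)) * killedFunctional V c φ u f fun r => x (s + r)|
      ≤ {y | y ∉ survival s}.indicator (fun _ => C * Real.exp (c * (s + u : ℝ≥0)))
        fun r => φ (x r) := by
  rw [hx.killedFunctional_add hV hc hφ f s u]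
  by_cases hs : (fun r => φ (x r)) ∈ survival s
  · simp [hs]
  · have hprod : |weight c s (fun r => V (x r)) * killedFunctional V c φ u f fun r => x (s + r)|
        ≤ Real.exp (c * s) * (C * Real.exp (c * u)) := by
      rw [abs_mul]
      exact mul_le_mul (abs_weight_le c s _) (abs_killedFunctional_le hC u _) (abs_nonneg _)
        (Real.exp_pos _).le
    have hexp : C * Real.exp (c * (s + u : ℝ≥0))
        = Real.exp (c * s) * (C * Real.exp (c * u)) := by
      rw [NNReal.coe_add, mul_add, Real.exp_add]
      ring
    simpa [hs, ← hexp] using hprod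

end Functional

variable {Ω S : Type*} [mΩ : MeasurableSpace Ω] [MeasurableSpace S] [PseudoMetricSpace S]
  [BorelSpace S] {P : Measure Ω} [IsProbabilityMeasure P] {𝓕 : S → Filtration ℝ≥0 mΩ}
  {X : S → ℝ≥0 → Ω → S} {V φ : S → ℝ} {c : ℝ} {D : Set S}

namespace IsCadlagStrongMarkov

lemma killedFeynmanKac_eq (hX : IsCadlagStrongMarkov P 𝓕 X) (hV : Continuous V)
    (hc : ∀ y, -c ≤ V y) (hSF : IsStrongFeller (transition P X)) (hφ : Continuous φ)
    (hφ₀ : ∀ y, 0 ≤ φ y) (hφD : ∀ y, φ y = 0 ↔ y ∉ D) (t : ℝ≥0) (f : D → ℝ) (z : D) :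
    killedFeynmanKac P X V D t f z
      = ∫ ω, killedFunctional V c φ t (Function.extend Subtype.val f 0) (fun s => X z s ω) ∂P := by
  refine integral_congr_ae ?_
  filter_upwards [hX.ae_exp_neg_potentialIntegral_eq hV hc z t,
    hX.ae_lt_exitTime_iff hSF hφ hφ₀ hφD z t] with ω hexp hexit
  rw [killedFunctional, ← hexp]
  exact congrArg _ (indicator_eq_indicator hexit rfl)

lemma feynmanKac_integral_killedFunctional (hX : IsCadlagStrongMarkov P 𝓕 X) (hV : Continuous V)
    (hc : ∀ y, -c ≤ V y) (hφ : Measurable φ) {f : S → ℝ} (hf : IsBoundedMeasurable f)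
    (s u : ℝ≥0) (z : S) :
    feynmanKac P X V s (fun y => ∫ ω, killedFunctional V c φ u f (fun r => X y r ω) ∂P) z
      = ∫ ω, weight c s (fun r => V (X z r ω))
          * killedFunctional V c φ u f (fun r => X z (s + r) ω) ∂P := by
  have hW : Measurable[𝓕 z s] fun ω => weight c s fun r => V (X z r ω) :=
    measurable_weight (fun r hr =>
      hV.measurable.comp ((hX.adapted z r).mono ((𝓕 z).mono hr) le_rfl)) c
  rw [hX.integral_mul_shift z s hW ⟨_, fun ω => abs_weight_le c s _⟩
    (isBoundedMeasurable_killedFunctional hV.measurable hφ hf u), hX.feynmanKac_eq hV hc]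
  exact integral_congr_ae (ae_of_all _ fun ω => mul_comm _ _)

/-- Ignoring the killing during the first `s` units of time only costs the probability of an exit
before `s`. -/
lemma abs_integral_killedFunctional_sub_le (hX : IsCadlagStrongMarkov P 𝓕 X)
    (hV : Continuous V) (hc : ∀ y, -c ≤ V y) (hSF : IsStrongFeller (transition P X))
    (hφ : Continuous φ) (hφ₀ : ∀ y, 0 ≤ φ y) (hφD : ∀ y, φ y = 0 ↔ y ∉ D) {f : S → ℝ}
    (hf : Measurable f) {C : ℝ} (hC : ∀ y, |f y| ≤ C) (s u : ℝ≥0) (z : S) :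
    |∫ ω, killedFunctional V c φ (s + u) f (fun r => X z r ω) ∂P
        - feynmanKac P X V s
            (fun y => ∫ ω, killedFunctional V c φ u f (fun r => X y r ω) ∂P) z|
      ≤ C * Real.exp (c * (s + u : ℝ≥0)) * P.real {ω | exitTime X D z ω ≤ s} := by
  have hfb : IsBoundedMeasurable f := ⟨hf, C, hC⟩
  have hΦ := isBoundedMeasurable_killedFunctional (c := c) hV.measurable hφ.measurable hfb
  have hweight : IsBoundedMeasurable fun x : ℝ≥0 → S => weight c s fun r => V (x r) :=
    ⟨measurable_weight (fun r _ => hV.measurable.comp (measurable_pi_apply r)) c, _,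
      fun x => abs_weight_le c s _⟩
  have hshift : Measurable fun (x : ℝ≥0 → S) r => x (s + r) :=
    measurable_pi_lambda _ fun r => measurable_pi_apply (s + r)
  have hpath := hX.measurable_path z
  set B : Set Ω := {ω | (fun r => φ (X z r ω)) ∉ survival s}
  have hB : MeasurableSet B := ((measurable_pi_lambda _ fun r =>
    hφ.measurable.comp (hX.measurable z r)) (measurableSet_survival s)).compl
  have hPB : P.real {ω | exitTime X D z ω ≤ s} = P.real B := measureReal_congr <|
    (hX.ae_lt_exitTime_iff hSF hφ hφ₀ hφD z s).mono fun ω hω =>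
      propext (not_lt.symm.trans (not_congr hω))
  rw [hX.feynmanKac_integral_killedFunctional hV hc hφ.measurable hfb, hPB,
    ← integral_sub ((hΦ (s + u)).integrable_comp hpath.aemeasurable)
      ((hweight.mul ((hΦ u).comp hshift)).integrable_comp hpath.aemeasurable)]
  refine (norm_integral_le_of_norm_le ((integrable_const _).indicator hB)
    ((hX.cadlag z).mono fun ω hω =>
      (Real.norm_eq_abs _).trans_le
        (hω.abs_killedFunctional_add_sub_le hV hc hφ hC s u))).trans_eq ?_
  rw [integral_indicator_const _ hB, smul_eq_mul, mul_comm]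

lemma tendstoUniformlyOn_feynmanKac_integral_killedFunctional (hX : IsCadlagStrongMarkov P 𝓕 X)
    (hV : Continuous V) (hc : ∀ y, -c ≤ V y) (hSF : IsStrongFeller (transition P X))
    (hφ : Continuous φ) (hφ₀ : ∀ y, 0 ≤ φ y) (hφD : ∀ y, φ y = 0 ↔ y ∉ D) {f : S → ℝ}
    (hf : IsBoundedMeasurable f) {t : ℝ≥0} (ht : 0 < t) {K : Set S}
    (hK : Tendsto (fun s : ℝ≥0 => ⨆ z ∈ K, P {ω | exitTime X D z ω ≤ s}) (𝓝[>] 0) (𝓝 0)) :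
    TendstoUniformlyOn
      (fun s => feynmanKac P X V s
        fun y => ∫ ω, killedFunctional V c φ (t - s) f (fun r => X y r ω) ∂P)
      (fun y => ∫ ω, killedFunctional V c φ t f (fun r => X y r ω) ∂P) (𝓝[>] 0) K := by
  obtain ⟨hfm, C, hC⟩ := hf
  refine Metric.tendstoUniformlyOn_iff.2 fun ε hε => ?_
  have hlim : Tendsto (fun s : ℝ≥0 => C * Real.exp (c * t)
      * (⨆ z ∈ K, P {ω | exitTime X D z ω ≤ s}).toReal) (𝓝[>] 0) (𝓝 0) := by
    simpa using ((ENNReal.tendsto_toReal ENNReal.zero_ne_top).comp hK).const_mul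
      (C * Real.exp (c * t))
  filter_upwards [hlim.eventually (gt_mem_nhds hε), nhdsWithin_le_nhds (gt_mem_nhds ht)]
    with s hs (hst : s < t) y hy
  obtain ⟨u, rfl⟩ := exists_add_of_le hst.le
  rw [add_tsub_cancel_left, Real.dist_eq]
  have hsup : P.real {ω | exitTime X D y ω ≤ s}
      ≤ (⨆ z ∈ K, P {ω | exitTime X D z ω ≤ s}).toReal :=
    ENNReal.toReal_mono ((iSup₂_le fun _ _ => prob_le_one).trans_lt ENNReal.one_lt_top).ne
      (le_iSup₂ (f := fun z (_ : z ∈ K) => P {ω | exitTime X D z ω ≤ s}) y hy)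
  have hC₀ : 0 ≤ C := (abs_nonneg _).trans (hC y)
  calc _ ≤ C * Real.exp (c * (s + u : ℝ≥0)) * P.real {ω | exitTime X D y ω ≤ s} :=
        hX.abs_integral_killedFunctional_sub_le hV hc hSF hφ hφ₀ hφD hfm hC s u y
    _ ≤ C * Real.exp (c * (s + u : ℝ≥0)) * (⨆ z ∈ K, P {ω | exitTime X D z ω ≤ s}).toReal :=
        mul_le_mul_of_nonneg_left hsup (by positivity)
    _ < ε := hs

lemma isStrongFeller_killedFeynmanKac [LocallyCompactSpace S] (hX : IsCadlagStrongMarkov P 𝓕 X)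
    (hV : Continuous V) (hc : ∀ y, -c ≤ V y) (hSF : IsStrongFeller (transition P X))
    (hFK : IsStrongFeller (feynmanKac P X V)) (hD : IsOpen D)
    (hB : ∀ K : Set S, IsCompact K → K ⊆ D →
      Tendsto (fun s : ℝ≥0 => ⨆ z ∈ K, P {ω | exitTime X D z ω ≤ s}) (𝓝[>] 0) (𝓝 0)) :
    IsStrongFeller (killedFeynmanKac P X V D) := by
  intro t ht f hf
  obtain ⟨φ, hφ, hφ₀, hφD⟩ := exists_continuous_eq_zero_iff hD
  set F : S → ℝ := Function.extend Subtype.val f 0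
  have hF : IsBoundedMeasurable F := hf.extend_subtype hD.measurableSet
  have hcont : ∀ z ∈ D, ContinuousAt
      (fun y => ∫ ω, killedFunctional V c φ t F (fun r => X y r ω) ∂P) z := by
    intro z hz
    obtain ⟨K, hK, hzK, hKD⟩ := exists_compact_subset hD hz
    have hunif := hX.tendstoUniformlyOn_feynmanKac_integral_killedFunctional hV hc hSF hφ hφ₀ hφD
      hF ht (hB K hK hKD)
    have hKcont := hunif.continuousOn <| Eventually.frequently <|
      eventually_mem_nhdsWithin.mono fun s (hs : 0 < s) =>
        (hFK s hs _ (hX.isBoundedMeasurable_integral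
          (isBoundedMeasurable_killedFunctional hV.measurable hφ.measurable hF _))).continuousOn
    exact hKcont.continuousAt (mem_interior_iff_mem_nhds.1 hzK)
  refine (continuous_iff_continuousAt.2 fun z : D =>
    (hcont z z.2).comp continuous_subtype_val.continuousAt).congr fun z => ?_
  exact (hX.killedFeynmanKac_eq hV hc hSF hφ hφ₀ hφD t f z).symm

end IsCadlagStrongMarkov

end Killed

end FeynmanKac

theorem theorem2p6_general {Ω S : Type*} [mΩ : MeasurableSpace Ω] [MeasurableSpace S]
    [PseudoMetricSpace S] [LocallyCompactSpace S] [BorelSpace S] {P : Measure Ω}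
    [IsProbabilityMeasure P] {𝓕 : S → Filtration ℝ≥0 mΩ} {X : S → ℝ≥0 → Ω → S}
    (hX : FeynmanKac.IsCadlagStrongMarkov P 𝓕 X) {V : S → ℝ} (hV : Continuous V)
    (hVbdd : BddBelow (range V))
    (hSF : FeynmanKac.IsStrongFeller (FeynmanKac.transition P X))
    (hP : ∀ (t : ℝ≥0) (z : S), TendstoInMeasure P (fun z' => X z' t) (𝓝 z) (X z t))
    (hIV : ∀ (t : ℝ≥0) (z : S) (zs : ℕ → S), Tendsto zs atTop (𝓝 z) →
      TendstoInMeasure P (fun n => FeynmanKac.potentialIntegral X V (zs n) t) atTop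
        (FeynmanKac.potentialIntegral X V z t)) :
    FeynmanKac.IsStrongFeller (FeynmanKac.feynmanKac P X V) ∧
    ∀ D : Set S, IsOpen D →
      (∀ K : Set S, IsCompact K → K ⊆ D →
        Tendsto (fun s : ℝ≥0 => ⨆ z ∈ K, P {ω | FeynmanKac.exitTime X D z ω ≤ s})
          (𝓝[>] 0) (𝓝 0)) →
      FeynmanKac.IsStrongFeller (FeynmanKac.killedFeynmanKac P X V D) := by
  obtain ⟨b, hb⟩ := hVbdd
  have hc : ∀ y, -(-b) ≤ V y := fun y => (neg_neg b).trans_le (hb (mem_range_self y))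
  have hFK := hX.isStrongFeller_feynmanKac hV hc hSF hP hIV
  exact ⟨hFK, fun D hD hB => hX.isStrongFeller_killedFeynmanKac hV hc hSF hFK hD hB⟩

theorem theorem2p6
    (k : ℕ) (hk : 2 ≤ k)
    -- the state space, an open subset of `ℝ^k`
    (M : Set (EuclideanSpace ℝ (Fin k))) (hM : IsOpen M)
    -- the process
    {Ω : Type*} [mΩ : MeasurableSpace Ω] (P : Measure Ω) [IsProbabilityMeasure P]
    (𝓕 : M → Filtration ℝ≥0 mΩ) (X : M → ℝ≥0 → Ω → M)
    (hX : FeynmanKac.IsCadlagStrongMarkov P 𝓕 X)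
    -- the potential
    (V : M → ℝ) (hVcont : Continuous V) (hVbdd : BddBelow (Set.range V))
    (hVint : ∀ (z : M) (t : ℝ≥0), ∀ᵐ ω ∂P,
      IntervalIntegrable (fun s : ℝ => V (X z s.toNNReal ω)) volume 0 (t : ℝ))
    -- the transition semigroup is strongly Feller
    (hSF0 : ∀ t : ℝ≥0, 0 < t → ∀ f : M → ℝ, FeynmanKac.IsBoundedMeasurable f →
      Continuous (FeynmanKac.transition P X t f))
    -- continuity in probability with respect to the start point
    (hP : ∀ (t : ℝ≥0) (z : M), TendstoInMeasure P (fun z' => X z' t) (𝓝 z) (X z t))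
    -- densities with respect to the Lebesgue measure
    (hD : ∀ t : ℝ≥0, 0 < t → ∀ z : M,
      HasPDF (fun ω => (X z t ω : EuclideanSpace ℝ (Fin k))) P volume)
    -- continuity in probability of the integral of the potential
    (hIV : ∀ (t : ℝ≥0) (z : M) (zs : ℕ → M), Tendsto zs atTop (𝓝 z) →
      TendstoInMeasure P (fun n => FeynmanKac.potentialIntegral X V (zs n) t) atTop
        (FeynmanKac.potentialIntegral X V z t)) :
    (∀ t : ℝ≥0, 0 < t → ∀ f : M → ℝ, FeynmanKac.IsBoundedMeasurable f →
      Continuous (FeynmanKac.feynmanKac P X V t f)) ∧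
    -- a subdomain `D` of `M`, on whose compact subsets the exit time is uniformly not small
    ∀ D : Set M, IsOpen D → IsConnected D →
      (∀ K : Set M, IsCompact K → K ⊆ D →
        Tendsto (fun s : ℝ≥0 => ⨆ z ∈ K, P {ω | FeynmanKac.exitTime X D z ω ≤ s})
          (𝓝[>] 0) (𝓝 0)) →
      ∀ t : ℝ≥0, 0 < t → ∀ f : D → ℝ, FeynmanKac.IsBoundedMeasurable f →
        Continuous (FeynmanKac.killedFeynmanKac P X V D t f) := by
  have := hM.locallyCompactSpace
  obtain ⟨hFK, hkilled⟩ := theorem2p6_general hX hVcont hVbdd hSF0 hP hIV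
  exact ⟨hFK, fun D hDo _ => hkilled D hDo⟩
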